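/- **Theorem C.1 (embedding theorem).** For positive integers $n_1,n_2,d_1,d_2$ with $n_1d_1=n_2d_2$, put $m=n_1d_1=n_2d_2$. Consider the following random simple bipartite graphs with left vertex set $[n_1]$ and right vertex set $[n_2]$: $\mathbb G_{n_1,n_2,k}$ is uniform among all such graphs with exactly $k$ edges; $\mathbb G_{n_1,n_2,p}$ contains each of the $n_1n_2$ potential edges independently with probability $p$; and $\mathbb R_{n_1,n_2,d_1,d_2}$ is uniform among all $(d_1,d_2)$-biregular graphs (every left vertex has degree $d_1$, every right vertex has degree $d_2$). There are a universal constant $C>0$ and a function $\delta:\mathbb N\to\mathbb R$ with $\delta(m)\to0$ as $m\to\infty$ such that the following holds for all $n_1,n_2,d_1,d_2,m$ as above and every $\gamma\in(0,1)$ with $$\gamma\ \ge\ C\left(\frac{d_1d_2}{m}+\frac{\log m}{\min\{d_1,d_2\}}\right)^{1/3}.$$ A $(d_1,d_2)$-biregular graph on $[n_1],[n_2]$ exists, and: 1. for every integer $0\le\widetilde m\le\lfloor(1-\gamma)m\rfloor$ there is a joint distribution of $G\sim\mathbb G_{n_1,n_2,\widetilde m}$ and $R\sim\mathbb R_{n_1,n_2,d_1,d_2}$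 such that $\Pr[G\subseteq R]\ge1-\delta(m)$; 2. if moreover $\gamma\le 1/2$, then $p:=\frac{(1-2\gamma)m}{n_1n_2}$ lies in $[0,1]$ and there is a joint distribution of $H\sim\mathbb G_{n_1,n_2,p}$ and $R\sim\mathbb R_{n_1,n_2,d_1,d_2}$ such that $\Pr[H\subseteq R]\ge1-\delta(m)$. -/

import Mathlib

open Filter Topology Finset
open scoped ENNReal BigOperators

/-- A simple bipartite graph with left vertex set `[n₁]` and right vertex set `[n₂]`, given by its
set of edges: a subset of the edge set `[n₁] × [n₂]` of the complete bipartite graph. The graph is a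
subgraph of another one exactly if `⊆` holds. -/
abbrev BipGraph (n₁ n₂ : ℕ) : Type := Finset (Fin n₁ × Fin n₂)

namespace BipGraph

/-- The degree of a left vertex. -/
def degLeft {n₁ n₂ : ℕ} (G : BipGraph n₁ n₂) (u : Fin n₁) : ℕ :=
  (G.filter fun e => e.1 = u).card

/-- The degree of a right vertex. -/
def degRight {n₁ n₂ : ℕ} (G : BipGraph n₁ n₂) (v : Fin n₂) : ℕ :=
  (G.filter fun e => e.2 = v).card

/-- Every left vertex has degree `d₁` and every right vertex has degree `d₂`. -/
def IsBiregular {n₁ n₂ : ℕ} (G : BipGraph n₁ n₂) (d₁ d₂ : ℕ) : Prop :=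
  (∀ u, G.degLeft u = d₁) ∧ ∀ v, G.degRight v = d₂

/-- The set of all bipartite graphs on `[n₁]`, `[n₂]` with exactly `k` edges. -/
def withEdges (n₁ n₂ k : ℕ) : Finset (BipGraph n₁ n₂) :=
  Finset.univ.filter fun G => G.card = k

open Classical in
/-- The set of all `(d₁, d₂)`-biregular bipartite graphs on `[n₁]`, `[n₂]`. -/
noncomputable def biregular (n₁ n₂ d₁ d₂ : ℕ) : Finset (BipGraph n₁ n₂) :=
  Finset.univ.filter fun G => G.IsBiregular d₁ d₂

/-- The weights `p ^ |G| * (1 - p) ^ (n₁ n₂ - |G|)` form a probability distribution. -/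
theorem sum_weights (n₁ n₂ : ℕ) (p : ℝ) (hp : p ∈ Set.Icc (0 : ℝ) 1) :
    ∑ G : BipGraph n₁ n₂, ENNReal.ofReal (p ^ G.card * (1 - p) ^ (n₁ * n₂ - G.card)) = 1 := by
  have h0 : 0 ≤ p := hp.1
  have h1 : 0 ≤ 1 - p := by linarith [hp.2]
  rw [← ENNReal.ofReal_sum_of_nonneg (fun G _ => by positivity)]
  have h := Fintype.sum_pow_mul_eq_add_pow (Fin n₁ × Fin n₂) p (1 - p)
  simp only [Fintype.card_prod, Fintype.card_fin] at h
  rw [h]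
  simp

/-- The Erdős–Rényi distribution `𝔾(n₁, n₂, p)`: each of the `n₁ n₂` potential edges is present
independently with probability `p`, so that a graph `G` has probability
`p ^ |G| * (1 - p) ^ (n₁ n₂ - |G|)`. -/
noncomputable def erdosRenyi (n₁ n₂ : ℕ) (p : ℝ) (hp : p ∈ Set.Icc (0 : ℝ) 1) :
    PMF (BipGraph n₁ n₂) :=
  PMF.ofFintype (fun G => ENNReal.ofReal (p ^ G.card * (1 - p) ^ (n₁ * n₂ - G.card)))
    (sum_weights n₁ n₂ p hp)

/-- `π` is a joint distribution of a random graph with law `μ` and a random graph with law `ν`. -/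
def IsCoupling {n₁ n₂ : ℕ} (π : PMF (BipGraph n₁ n₂ × BipGraph n₁ n₂))
    (μ ν : PMF (BipGraph n₁ n₂)) : Prop :=
  π.map Prod.fst = μ ∧ π.map Prod.snd = ν

/-- The probability that the first graph is a subgraph of the second, for a pair of graphs with
joint distribution `π`. -/
noncomputable def probSubgraph {n₁ n₂ : ℕ} (π : PMF (BipGraph n₁ n₂ × BipGraph n₁ n₂)) : ℝ :=
  (π.toOuterMeasure {x | x.1 ⊆ x.2}).toReal

end BipGraph

/-!
The edges of a uniformly random biregular graph `R` are revealed one at a time in random order. Let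
`G` be the graph of the first `t` edges and `r(G)` the number of biregular graphs that contain `G`
(`extensions`). The next edge is `e` with probability `r(G ∪ e) / ((m - t) r(G))` (`nextEdge`), and
the point is that this is at least `(1 - ε) / (n₁ n₂)` with `ε = γ / 16`, for *every* `e ∉ G`, as long
as `t ≤ (1 - γ / 4) m` and `G` is balanced, that is, the residual degrees of all vertices are within
a factor `1 ± γ / 64` of their expectation (`Balanced.le_card_extensions_insert`).

This bound comes from switching along cycles of length four (`card_switch`): an edge `e = (u, v)` is
brought into a biregular graph `H ⊇ G` by removing edges `(u, y)`, `(x, v)` of `H` outside `G` and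
inserting `(u, v)`, `(x, y)`. Counting switchings in both directions first gives the crude upper bound
`r(G ∪ e) ≤ 8 τ p r(G)`, where `p = d₁ d₂ / m` is the edge density and `τ = 1 - t / m`
(`card_extensions_insert_le`). Applied two or three times, it shows that only a proportion `O(p)` of
the pairs of edges at `u` and `v` fail to be switchable on average, because they are joined by an
edge `(x, y)` of `H`; this yields the matching lower bound (`le_card_extensions_insert`).

The revealed part of `R` is a uniform `t`-subset of its edges, so that its residual degrees are
hypergeometric, and a Chernoff bound (`Finset.card_filter_card_sdiff_deviation_le`) makes all of them
balanced at all times with probability at least `1 - 4 / m`. Here the cube in the condition on `γ` is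
used: the exponent is of order `τ d (γ / 64)²` with `τ ≥ γ / 4` and `d ∈ {d₁, d₂}`.

Consequently the process can be coupled with independent random edges, each absent with probability
`ε` and uniform on `[n₁] × [n₂]` otherwise, such that the graph `S` formed by the latter stays inside
the revealed part of `R` (`couples_process`). The probability of `S` depends on its number of edges
only, and `S` has at least `(1 - γ) m` edges with probability at least `1 - 1 / m`, so that a random
subset of `S` of size `k ≤ (1 - γ) m` is a uniform graph with `k` edges (`mix_thin`). Averaging over
the number of edges carries the result over to the Erdős–Rényi graph (`couples_erWeight`).

Random graphs are described by real-valued weight functions in the standard simplex; joint laws are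
turned into probability mass functions by `exists_pmf_of_couples`.
-/

/-! ### Couplings of finitely supported laws -/

namespace FiniteLaw

variable {α β α' β' : Type*} [Fintype α] [Fintype β] [Fintype α'] [Fintype β']

/-- The law of the second coordinate when the first is drawn from `μ` and the second, given the first
is `a`, from `k a`. -/
def mix (μ : α → ℝ) (k : α → β → ℝ) : β → ℝ := fun b => ∑ a, μ a * k a b

/-- The uniform law on a finite set. -/
noncomputable def unif [DecidableEq α] (s : Finset α) : α → ℝ := fun a => if a ∈ s then (#s : ℝ)⁻¹ else 0

open Classical in
/-- The laws `μ` and `ν` have a joint law under which the relation `r` fails with probability at most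
`δ`. -/
def Couples (r : α → β → Prop) (μ : α → ℝ) (ν : β → ℝ) (δ : ℝ) : Prop :=
  ∃ w : α × β → ℝ, (∀ x, 0 ≤ w x) ∧ (∀ a, ∑ b, w (a, b) = μ a) ∧ (∀ b, ∑ a, w (a, b) = ν b) ∧
    ∑ x with ¬ r x.1 x.2, w x ≤ δ

lemma mix_mem {μ : α → ℝ} {k : α → β → ℝ} (hμ : μ ∈ stdSimplex ℝ α)
    (hk : ∀ a, μ a ≠ 0 → k a ∈ stdSimplex ℝ β) : mix μ k ∈ stdSimplex ℝ β := by
  constructor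
  · intro b
    refine sum_nonneg fun a _ => ?_
    by_cases h : μ a = 0
    · simp [h]
    · exact mul_nonneg (hμ.1 a) ((hk a h).1 b)
  · unfold mix
    rw [sum_comm, ← hμ.2]
    refine sum_congr rfl fun a _ => ?_
    rw [← mul_sum]
    by_cases h : μ a = 0
    · simp [h]
    · rw [(hk a h).2, mul_one]

lemma unif_mem [DecidableEq α] {s : Finset α} (hs : s.Nonempty) : unif s ∈ stdSimplex ℝ α := by
  constructor
  · intro a
    unfold unif
    split_ifs <;> positivity
  · have : (#s : ℝ) ≠ 0 := by exact_mod_cast hs.card_pos.ne'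
    simp [unif, this]

lemma mix_single [DecidableEq α] (μ : α → ℝ) : mix μ (fun a => Pi.single a 1) = μ := by
  ext b
  simp [mix, Pi.single_apply]

lemma Couples.mono {r r' : α → β → Prop} {μ : α → ℝ} {ν : β → ℝ} {δ δ' : ℝ}
    (h : Couples r μ ν δ) (hr : ∀ a b, r a b → r' a b) (hδ : δ ≤ δ') : Couples r' μ ν δ' := by
  classical
  obtain ⟨w, h0, h1, h2, h3⟩ := h
  refine ⟨w, h0, h1, h2, le_trans ?_ (h3.trans hδ)⟩
  refine sum_le_sum_of_subset_of_nonneg ?_ fun x _ _ => h0 x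
  intro x hx
  simp only [mem_filter, mem_univ, true_and] at hx ⊢
  exact fun h => hx (hr _ _ h)

/-- A partial coupling extends to a coupling by matching the remaining masses independently. -/
lemma couples_of_partial {r : α → β → Prop} {μ : α → ℝ} {ν : β → ℝ}
    (hμ : μ ∈ stdSimplex ℝ α) (hν : ν ∈ stdSimplex ℝ β) (c : α × β → ℝ) (hc : ∀ x, 0 ≤ c x)
    (h1 : ∀ a, ∑ b, c (a, b) ≤ μ a) (h2 : ∀ b, ∑ a, c (a, b) ≤ ν b)
    (hr : ∀ a b, c (a, b) ≠ 0 → r a b)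
    (hr' : ∀ a b, ∑ b, c (a, b) ≠ μ a → ∑ a, c (a, b) ≠ ν b → r a b) : Couples r μ ν 0 := by
  classical
  set θ : ℝ := 1 - ∑ a, ∑ b, c (a, b) with hθ
  have s1 : ∑ a, (μ a - ∑ b, c (a, b)) = θ := by rw [sum_sub_distrib, hμ.2]
  have s2 : ∑ b, (ν b - ∑ a, c (a, b)) = θ := by rw [sum_sub_distrib, hν.2, sum_comm]
  have p1 : ∀ a, 0 ≤ μ a - ∑ b, c (a, b) := fun a => sub_nonneg.2 (h1 a)
  have p2 : ∀ b, 0 ≤ ν b - ∑ a, c (a, b) := fun b => sub_nonneg.2 (h2 b)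
  have hθ0 : 0 ≤ θ := s1 ▸ sum_nonneg fun a _ => p1 a
  have z1 : θ = 0 → ∀ a, μ a - ∑ b, c (a, b) = 0 := fun h a =>
    (sum_eq_zero_iff_of_nonneg fun a _ => p1 a).1 (s1.trans h) a (mem_univ a)
  have z2 : θ = 0 → ∀ b, ν b - ∑ a, c (a, b) = 0 := fun h b =>
    (sum_eq_zero_iff_of_nonneg fun b _ => p2 b).1 (s2.trans h) b (mem_univ b)
  refine ⟨fun x => c x + (μ x.1 - ∑ b, c (x.1, b)) * (ν x.2 - ∑ a, c (a, x.2)) / θ,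
    fun x => add_nonneg (hc x) (div_nonneg (mul_nonneg (p1 _) (p2 _)) hθ0), ?_, ?_, ?_⟩
  · intro a
    dsimp only
    rw [sum_add_distrib, ← sum_div, ← mul_sum, s2]
    by_cases h : θ = 0
    · have := z1 h a
      simp only [h, div_zero]
      linarith
    · field_simp
      ring
  · intro b
    dsimp only
    rw [sum_add_distrib, ← sum_div, ← sum_mul, s1]
    by_cases h : θ = 0
    · have := z2 h b
      simp only [h, div_zero]
      linarith
    · field_simp
      ring
  · refine le_of_eq (sum_eq_zero fun x hx => ?_)
    simp only [mem_filter, mem_univ, true_and] at hx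
    have e1 : c x = 0 := by
      by_contra h
      exact hx (hr x.1 x.2 h)
    have e2 : (μ x.1 - ∑ b, c (x.1, b)) * (ν x.2 - ∑ a, c (a, x.2)) = 0 := by
      by_contra h
      have := mul_ne_zero_iff.1 h
      exact hx (hr' x.1 x.2 (fun h => this.1 (by rw [h, sub_self]))
        (fun h => this.2 (by rw [h, sub_self])))
    rw [e1, e2, zero_div, add_zero]

lemma couples_true {μ : α → ℝ} {ν : β → ℝ} (hμ : μ ∈ stdSimplex ℝ α) (hν : ν ∈ stdSimplex ℝ β) :
    Couples (fun _ _ => True) μ ν 0 :=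
  couples_of_partial hμ hν 0 (by simp) (by simpa using hμ.1) (by simpa using hν.1)
    (fun _ _ _ => trivial) (fun _ _ _ _ => trivial)

lemma couples_one (r : α → β → Prop) {μ : α → ℝ} {ν : β → ℝ} (hμ : μ ∈ stdSimplex ℝ α)
    (hν : ν ∈ stdSimplex ℝ β) : Couples r μ ν 1 := by
  classical
  obtain ⟨w, h0, h1, h2, -⟩ := couples_true hμ hν
  refine ⟨w, h0, h1, h2, ?_⟩
  calc ∑ x with ¬ r x.1 x.2, w x ≤ ∑ x, w x :=
        sum_le_sum_of_subset_of_nonneg (filter_subset _ _) fun x _ _ => h0 x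
    _ = 1 := by
        rw [Fintype.sum_prod_type, ← hμ.2]
        exact sum_congr rfl fun a _ => h1 a

open Classical in
/-- Couplings compose with random steps. The steps need to be coupled well only from pairs in `r`
that avoid the exceptional sets `A` and `B`, whose probabilities are added to the error. -/
lemma Couples.mix {r : α → β → Prop} {r' : α' → β' → Prop} {μ : α → ℝ} {ν : β → ℝ}
    {k : α → α' → ℝ} {l : β → β' → ℝ} {δ η δA δB : ℝ} (A : α → Prop) (B : β → Prop)
    (h : Couples r μ ν δ) (hμ : μ ∈ stdSimplex ℝ α) (hη : 0 ≤ η)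
    (hk : ∀ a, μ a ≠ 0 → k a ∈ stdSimplex ℝ α') (hl : ∀ b, ν b ≠ 0 → l b ∈ stdSimplex ℝ β')
    (hA : ∑ a with A a, μ a ≤ δA) (hB : ∑ b with B b, ν b ≤ δB)
    (hstep : ∀ a b, r a b → ¬ A a → ¬ B b → μ a ≠ 0 → ν b ≠ 0 → Couples r' (k a) (l b) η) :
    Couples r' (mix μ k) (mix ν l) (δ + δA + δB + η) := by
  obtain ⟨w, w0, w1, w2, w3⟩ := h
  have wμ : ∀ x, w x ≠ 0 → μ x.1 ≠ 0 := fun x hx h => hx <|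
    (sum_eq_zero_iff_of_nonneg fun b _ => w0 (x.1, b)).1 ((w1 x.1).trans h) x.2 (mem_univ _)
  have wν : ∀ x, w x ≠ 0 → ν x.2 ≠ 0 := fun x hx h => hx <|
    (sum_eq_zero_iff_of_nonneg fun a _ => w0 (a, x.2)).1 ((w2 x.2).trans h) x.1 (mem_univ _)
  have key : ∀ x : α × β, ∃ c : α' × β' → ℝ, w x ≠ 0 → (∀ y, 0 ≤ c y) ∧
      (∀ a, ∑ b, c (a, b) = k x.1 a) ∧ (∀ b, ∑ a, c (a, b) = l x.2 b) ∧
      ∑ y with ¬ r' y.1 y.2, c y ≤ (if r x.1 x.2 then 0 else 1) + (if A x.1 then 1 else 0) +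
        (if B x.2 then 1 else 0) + η := by
    intro x
    by_cases hx : w x = 0
    · exact ⟨0, fun h => absurd hx h⟩
    · have : Couples r' (k x.1) (l x.2) ((if r x.1 x.2 then 0 else 1) +
          (if A x.1 then 1 else 0) + (if B x.2 then 1 else 0) + η) := by
        by_cases hg : r x.1 x.2 ∧ ¬ A x.1 ∧ ¬ B x.2
        · refine (hstep _ _ hg.1 hg.2.1 hg.2.2 (wμ x hx) (wν x hx)).mono (fun _ _ h => h) ?_
          simp [hg]
        · refine (couples_one r' (hk _ (wμ x hx)) (hl _ (wν x hx))).mono (fun _ _ h => h) ?_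
          have : ¬ r x.1 x.2 ∨ A x.1 ∨ B x.2 := by tauto
          split_ifs <;> simp_all <;> linarith
      obtain ⟨c, hc⟩ := this
      exact ⟨c, fun _ => hc⟩
  choose c hc using key
  refine ⟨fun y => ∑ x, w x * c x y, fun y => sum_nonneg fun x _ => ?_, fun a' => ?_, fun b' => ?_,
    ?_⟩
  · by_cases hx : w x = 0
    · simp [hx]
    · exact mul_nonneg (w0 x) ((hc x hx).1 y)
  · rw [sum_comm]
    calc ∑ x, ∑ b', w x * c x (a', b') = ∑ x, w x * k x.1 a' := by
          refine sum_congr rfl fun x _ => ?_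
          rw [← mul_sum]
          by_cases hx : w x = 0
          · simp [hx]
          · rw [(hc x hx).2.1]
      _ = FiniteLaw.mix μ k a' := by
          rw [Fintype.sum_prod_type]
          refine sum_congr rfl fun a _ => ?_
          dsimp only
          rw [← sum_mul, w1]
  · rw [sum_comm]
    calc ∑ x, ∑ a', w x * c x (a', b') = ∑ x, w x * l x.2 b' := by
          refine sum_congr rfl fun x _ => ?_
          rw [← mul_sum]
          by_cases hx : w x = 0
          · simp [hx]
          · rw [(hc x hx).2.2.1]
      _ = FiniteLaw.mix ν l b' := by
          rw [Fintype.sum_prod_type_right]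
          refine sum_congr rfl fun b _ => ?_
          dsimp only
          rw [← sum_mul, w2]
  · rw [sum_comm]
    calc ∑ x, ∑ y with ¬ r' y.1 y.2, w x * c x y
        ≤ ∑ x, w x * ((if r x.1 x.2 then 0 else 1) + (if A x.1 then 1 else 0) +
          (if B x.2 then 1 else 0) + η) := by
          refine sum_le_sum fun x _ => ?_
          rw [← mul_sum]
          by_cases hx : w x = 0
          · simp [hx]
          · exact mul_le_mul_of_nonneg_left (hc x hx).2.2.2 (w0 x)
      _ = ∑ x with ¬ r x.1 x.2, w x + ∑ a with A a, μ a + ∑ b with B b, ν b + η := by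
          simp only [mul_add, sum_add_distrib]
          congr 1
          · congr 1
            · congr 1
              · rw [sum_filter]
                exact sum_congr rfl fun x _ => by split_ifs <;> simp_all
              · rw [sum_filter, Fintype.sum_prod_type]
                refine sum_congr rfl fun a _ => ?_
                split_ifs <;> simp [w1]
            · rw [sum_filter, Fintype.sum_prod_type_right]
              refine sum_congr rfl fun b _ => ?_
              split_ifs <;> simp [w2]
          · rw [← sum_mul, Fintype.sum_prod_type]
            simp [w1, hμ.2]
      _ ≤ δ + δA + δB + η := by gcongr

end FiniteLaw

namespace BipGraph

open FiniteLaw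

lemma toReal_uniformOfFinset {α : Type*} [DecidableEq α] {s : Finset α} (hs : s.Nonempty) :
    (fun a => (PMF.uniformOfFinset s hs a).toReal) = unif s := by
  ext a
  simp only [PMF.uniformOfFinset_apply, unif]
  split_ifs <;> simp

/-- Real weights that couple two probability mass functions on graphs give a joint probability mass
function. -/
lemma exists_pmf_of_couples {n₁ n₂ : ℕ} {μ ν : PMF (BipGraph n₁ n₂)} {δ : ℝ}
    (h : Couples (fun G H : BipGraph n₁ n₂ => G ⊆ H) (fun G => (μ G).toReal)
      (fun G => (ν G).toReal) δ) :
    ∃ π : PMF (BipGraph n₁ n₂ × BipGraph n₁ n₂), IsCoupling π μ ν ∧ 1 - δ ≤ probSubgraph π := by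
  classical
  obtain ⟨w, w0, w1, w2, w3⟩ := h
  have hsum : ∑ x, w x = 1 := by
    rw [Fintype.sum_prod_type]
    simp only [w1]
    rw [← ENNReal.toReal_sum fun a _ => μ.apply_ne_top a, ← tsum_fintype (L := .unconditional _),
      μ.tsum_coe, ENNReal.toReal_one]
  have hE : ∑ x, ENNReal.ofReal (w x) = 1 := by
    rw [← ENNReal.ofReal_sum_of_nonneg fun x _ => w0 x, hsum, ENNReal.ofReal_one]
  refine ⟨PMF.ofFintype (fun x => ENNReal.ofReal (w x)) hE, ⟨?_, ?_⟩, ?_⟩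
  · ext a
    rw [PMF.map_apply, tsum_fintype, Fintype.sum_prod_type, sum_eq_single a]
    · simp only [if_true, PMF.ofFintype_apply]
      rw [← ENNReal.ofReal_sum_of_nonneg fun x _ => w0 _, w1,
        ENNReal.ofReal_toReal (μ.apply_ne_top a)]
    · intro b _ hb
      simp [hb.symm]
    · simp
  · ext a
    rw [PMF.map_apply, tsum_fintype, Fintype.sum_prod_type_right, sum_eq_single a]
    · simp only [if_true, PMF.ofFintype_apply]
      rw [← ENNReal.ofReal_sum_of_nonneg fun x _ => w0 _, w2,
        ENNReal.ofReal_toReal (ν.apply_ne_top a)]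
    · intro b _ hb
      simp [hb.symm]
    · simp
  · have e : probSubgraph (PMF.ofFintype (fun x => ENNReal.ofReal (w x)) hE) =
        ∑ x with x.1 ⊆ x.2, w x := by
      unfold probSubgraph
      rw [PMF.toOuterMeasure_apply_fintype, ENNReal.toReal_sum]
      · rw [sum_filter]
        refine sum_congr rfl fun x _ => ?_
        by_cases hx : x.1 ⊆ x.2
        · simp [hx, w0 x]
        · simp [hx]
      · intro x _
        exact ((Set.indicator_le_self _ _ _).trans_lt (PMF.apply_lt_top _ _)).ne
    have := sum_filter_add_sum_filter_not univ
      (fun x : BipGraph n₁ n₂ × BipGraph n₁ n₂ => x.1 ⊆ x.2) w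
    have w3' : ∑ x with ¬ x.1 ⊆ x.2, w x ≤ δ := by convert w3
    rw [e]
    linarith

end BipGraph

/-! ### Switchings of biregular graphs -/

namespace BipGraph

variable {n₁ n₂ d₁ d₂ : ℕ}

/-- The biregular graphs that contain `G`. -/
noncomputable def extensions (d₁ d₂ : ℕ) (G : BipGraph n₁ n₂) : Finset (BipGraph n₁ n₂) :=
  (biregular n₁ n₂ d₁ d₂).filter fun H => G ⊆ H

lemma mem_biregular {H : BipGraph n₁ n₂} :
    H ∈ biregular n₁ n₂ d₁ d₂ ↔ H.IsBiregular d₁ d₂ := by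
  simp [biregular]

lemma mem_extensions {G H : BipGraph n₁ n₂} :
    H ∈ extensions d₁ d₂ G ↔ H.IsBiregular d₁ d₂ ∧ G ⊆ H := by
  simp [extensions, biregular]

lemma extensions_insert (e : Fin n₁ × Fin n₂) (G : BipGraph n₁ n₂) :
    extensions d₁ d₂ (insert e G) = (extensions d₁ d₂ G).filter fun H => e ∈ H := by
  ext H
  simp [mem_extensions, insert_subset_iff]
  tauto

lemma degLeft_mono {G H : BipGraph n₁ n₂} (h : G ⊆ H) (u : Fin n₁) : G.degLeft u ≤ H.degLeft u :=
  card_le_card (filter_subset_filter _ h)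

lemma degRight_mono {G H : BipGraph n₁ n₂} (h : G ⊆ H) (v : Fin n₂) :
    G.degRight v ≤ H.degRight v :=
  card_le_card (filter_subset_filter _ h)

lemma sum_degLeft (G : BipGraph n₁ n₂) : ∑ u, G.degLeft u = #G :=
  (card_eq_sum_card_fiberwise (f := Prod.fst) (t := univ) (by simp)).symm

lemma IsBiregular.card_eq {H : BipGraph n₁ n₂} (h : H.IsBiregular d₁ d₂) : #H = n₁ * d₁ := by
  rw [← sum_degLeft]
  simp [h.1]

lemma filter_sdiff_eq {α : Type*} [DecidableEq α] (P : α → Prop) [DecidablePred P] (s t : Finset α) :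
    (s \ t).filter P = s.filter P \ t.filter P := by
  ext a
  simp only [mem_filter, Finset.mem_sdiff]
  tauto

lemma degLeft_sdiff {G H : BipGraph n₁ n₂} (h : G ⊆ H) (u : Fin n₁) :
    ((H \ G).degLeft u : ℝ) = H.degLeft u - G.degLeft u := by
  unfold degLeft
  rw [filter_sdiff_eq, card_sdiff_of_subset (filter_subset_filter _ h),
    Nat.cast_sub (card_le_card (filter_subset_filter _ h))]

lemma degRight_sdiff {G H : BipGraph n₁ n₂} (h : G ⊆ H) (v : Fin n₂) :
    ((H \ G).degRight v : ℝ) = H.degRight v - G.degRight v := by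
  unfold degRight
  rw [filter_sdiff_eq, card_sdiff_of_subset (filter_subset_filter _ h),
    Nat.cast_sub (card_le_card (filter_subset_filter _ h))]

lemma card_filter_left (H : BipGraph n₁ n₂) (u : Fin n₁) :
    #{y | (u, y) ∈ H} = H.degLeft u := by
  refine card_nbij' (fun y => (u, y)) Prod.snd ?_ ?_ ?_ ?_ <;> intro z <;> aesop

lemma card_filter_right (H : BipGraph n₁ n₂) (v : Fin n₂) :
    #{x | (x, v) ∈ H} = H.degRight v := by
  refine card_nbij' (fun x => (x, v)) Prod.fst ?_ ?_ ?_ ?_ <;> intro z <;> aesop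

lemma card_swap {α : Type*} [DecidableEq α] {H A B : Finset α} (P : α → Prop) [DecidablePred P]
    (hA : A ⊆ H) (hB : Disjoint B H) (h : #(A.filter P) = #(B.filter P)) :
    #((H \ A ∪ B).filter P) = #(H.filter P) := by
  rw [filter_union, card_union_of_disjoint, filter_sdiff_eq,
    card_sdiff_of_subset (filter_subset_filter _ hA), ← h,
    Nat.sub_add_cancel (card_le_card (filter_subset_filter _ hA))]
  exact disjoint_filter_filter (hB.symm.mono_left sdiff_subset)

lemma IsBiregular.swap {H A B : BipGraph n₁ n₂} (h : H.IsBiregular d₁ d₂) (hA : A ⊆ H)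
    (hB : Disjoint B H) (hl : ∀ u, A.degLeft u = B.degLeft u)
    (hr : ∀ v, A.degRight v = B.degRight v) : (H \ A ∪ B).IsBiregular d₁ d₂ :=
  ⟨fun u => (card_swap _ hA hB (hl u)).trans (h.1 u),
    fun v => (card_swap _ hA hB (hr v)).trans (h.2 v)⟩

/-- The two edges that complete the disjoint edges `e` and `f` to a cycle of length four. -/
def cross (e f : Fin n₁ × Fin n₂) : BipGraph n₁ n₂ := {(e.1, f.2), (f.1, e.2)}

lemma degLeft_cross {e f : Fin n₁ × Fin n₂} (h₁ : f.1 ≠ e.1) (u : Fin n₁) :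
    (cross e f).degLeft u = degLeft {e, f} u := by
  obtain ⟨a, b⟩ := e
  obtain ⟨x, y⟩ := f
  simp only [cross, degLeft, filter_insert, filter_singleton]
  split_ifs <;> simp_all

lemma degRight_cross {e f : Fin n₁ × Fin n₂} (h₂ : f.2 ≠ e.2) (v : Fin n₂) :
    (cross e f).degRight v = degRight {e, f} v := by
  obtain ⟨a, b⟩ := e
  obtain ⟨x, y⟩ := f
  simp only [cross, degRight, filter_insert, filter_singleton]
  split_ifs <;> simp_all

/-- Exchanging `cross e f` for `{e, f}` is a bijection between the pairs `(H, f)` for which this is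
possible and produces `e`, and the pairs for which the reverse exchange is possible. Edges of `G` are
never removed. -/
lemma card_switch {G : BipGraph n₁ n₂} {e : Fin n₁ × Fin n₂} (he : e ∉ G) :
    ∑ H ∈ extensions d₁ d₂ G with e ∉ H, #{f | f ∉ H ∧ cross e f ⊆ H \ G} =
      ∑ H ∈ extensions d₁ d₂ (insert e G), #{f ∈ H \ G | Disjoint (cross e f) H} := by
  rw [← card_sigma, ← card_sigma]
  refine card_nbij' (fun z => ⟨z.1 \ cross e z.2 ∪ {e, z.2}, z.2⟩)
    (fun z => ⟨z.1 \ {e, z.2} ∪ cross e z.2, z.2⟩) ?_ ?_ ?_ ?_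
  · rintro ⟨H, f⟩ hz
    simp only [coe_sigma, Set.mem_sigma_iff, mem_coe, mem_filter, mem_extensions, mem_univ,
      true_and] at hz ⊢
    obtain ⟨⟨⟨hb, hG⟩, heH⟩, hf, hc⟩ := hz
    have hc1 : (e.1, f.2) ∈ H \ G := hc (by simp [cross])
    have hc2 : (f.1, e.2) ∈ H \ G := hc (by simp [cross])
    rw [Finset.mem_sdiff] at hc1 hc2
    have h₁ : f.1 ≠ e.1 := fun h => heH (by rw [h] at hc2; exact hc2.1)
    have h₂ : f.2 ≠ e.2 := fun h => heH (by rw [h] at hc1; exact hc1.1)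
    refine ⟨⟨hb.swap (hc.trans sdiff_subset) ?_ (degLeft_cross h₁) (degRight_cross h₂), ?_⟩, ?_, ?_⟩
    · simp [heH, hf]
    · rw [insert_subset_iff]
      refine ⟨by simp, fun g hg => ?_⟩
      have : g ∉ cross e f := fun h => (Finset.mem_sdiff.1 (hc h)).2 hg
      simp [hG hg, this]
    · have : f ∉ G := fun h => hf (hG h)
      simp [this]
    · rw [disjoint_left]
      intro g hg hg'
      simp only [mem_union, Finset.mem_sdiff, hg, not_true, and_false, false_or, mem_insert,
        mem_singleton] at hg'
      have := (Finset.mem_sdiff.1 (hc hg)).1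
      rcases hg' with rfl | rfl
      · exact heH this
      · exact hf this
  · rintro ⟨H, f⟩ hz
    simp only [coe_sigma, Set.mem_sigma_iff, mem_coe, mem_filter, mem_extensions, mem_univ,
      true_and, insert_subset_iff] at hz ⊢
    obtain ⟨⟨hb, heH, hG⟩, hf, hc⟩ := hz
    rw [Finset.mem_sdiff] at hf
    have hc1 : (e.1, f.2) ∉ H := disjoint_left.1 hc (by simp [cross])
    have hc2 : (f.1, e.2) ∉ H := disjoint_left.1 hc (by simp [cross])
    have h₁ : f.1 ≠ e.1 := fun h => hc2 (by rw [h]; exact heH)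
    have h₂ : f.2 ≠ e.2 := fun h => hc1 (by rw [h]; exact heH)
    have hec : e ∉ cross e f := fun h => disjoint_left.1 hc h heH
    have hfc : f ∉ cross e f := fun h => disjoint_left.1 hc h hf.1
    refine ⟨⟨⟨hb.swap ?_ hc (fun u => (degLeft_cross h₁ u).symm)
      (fun v => (degRight_cross h₂ v).symm), ?_⟩, ?_⟩, ?_, ?_⟩
    · simp [insert_subset_iff, heH, hf.1]
    · intro g hg
      have : g ≠ e := fun h => he (h ▸ hg)
      have : g ≠ f := fun h => hf.2 (h ▸ hg)
      simp [*, hG hg]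
    · simp [hec]
    · simp [hfc]
    · intro g hg
      have : g ∉ G := fun h => disjoint_left.1 hc hg (hG h)
      simp [hg, this]
  · rintro ⟨H, f⟩ hz
    simp only [coe_sigma, Set.mem_sigma_iff, mem_coe, mem_filter, mem_extensions, mem_univ,
      true_and] at hz
    obtain ⟨⟨⟨hb, hG⟩, heH⟩, hf, hc⟩ := hz
    have h1 : Disjoint (H \ cross e f) {e, f} := by simp [heH, hf]
    simp only [union_sdiff_right, sdiff_eq_self_of_disjoint h1,
      sdiff_union_of_subset (hc.trans sdiff_subset)]
  · rintro ⟨H, f⟩ hz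
    simp only [coe_sigma, Set.mem_sigma_iff, mem_coe, mem_filter, mem_extensions,
      insert_subset_iff] at hz
    obtain ⟨⟨hb, heH, hG⟩, hf, hc⟩ := hz
    have h1 : Disjoint (H \ {e, f}) (cross e f) := hc.symm.mono_left sdiff_subset
    have h2 : ({e, f} : BipGraph n₁ n₂) ⊆ H := by
      simp [insert_subset_iff, heH, (Finset.mem_sdiff.1 hf).1]
    simp only [union_sdiff_right, sdiff_eq_self_of_disjoint h1, sdiff_union_of_subset h2]

lemma card_filter_cross_subset (K : BipGraph n₁ n₂) (e : Fin n₁ × Fin n₂) :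
    #{f | cross e f ⊆ K} = K.degLeft e.1 * K.degRight e.2 := by
  rw [← card_filter_left, ← card_filter_right, mul_comm, ← card_product]
  congr 1
  ext ⟨x, y⟩
  simp [cross, insert_subset_iff, and_comm]

/-- The vertices lack at most `A` (on the left) and `B` (on the right) edges to degrees `d₁`, `d₂`. -/
def ResidualLE (d₁ d₂ : ℕ) (G : BipGraph n₁ n₂) (A B : ℝ) : Prop :=
  (∀ u, (d₁ : ℝ) - G.degLeft u ≤ A) ∧ ∀ v, (d₂ : ℝ) - G.degRight v ≤ B

lemma ResidualLE.mono {G H : BipGraph n₁ n₂} {A B : ℝ} (h : ResidualLE d₁ d₂ G A B)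
    (hGH : G ⊆ H) : ResidualLE d₁ d₂ H A B := by
  refine ⟨fun u => le_trans ?_ (h.1 u), fun v => le_trans ?_ (h.2 v)⟩
  · have : (G.degLeft u : ℝ) ≤ H.degLeft u := by exact_mod_cast degLeft_mono hGH u
    linarith
  · have : (G.degRight v : ℝ) ≤ H.degRight v := by exact_mod_cast degRight_mono hGH v
    linarith

lemma card_filter_left_adj_le {G H : BipGraph n₁ n₂} {A B : ℝ} (hH : H ∈ extensions d₁ d₂ G)
    (hG : ResidualLE d₁ d₂ G A B) (v : Fin n₂) :
    (#{f ∈ H \ G | (f.1, v) ∈ H} : ℝ) ≤ d₂ * A := by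
  rw [mem_extensions] at hH
  rw [card_eq_sum_card_fiberwise (f := Prod.fst) (t := {x | (x, v) ∈ H})
    (by intro f; simp)]
  push_cast
  have : ∀ x ∈ ({x | (x, v) ∈ H} : Finset (Fin n₁)),
      (#{f ∈ {f ∈ H \ G | (f.1, v) ∈ H} | f.1 = x} : ℝ) ≤ A := by
    intro x _
    refine le_trans ?_ (hG.1 x)
    rw [← hH.1.1 x, ← degLeft_sdiff hH.2]
    exact_mod_cast card_le_card (filter_subset_filter _ (filter_subset _ _))
  refine (sum_le_sum this).trans ?_
  rw [sum_const, card_filter_right, hH.1.2, nsmul_eq_mul]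

lemma card_filter_right_adj_le {G H : BipGraph n₁ n₂} {A B : ℝ} (hH : H ∈ extensions d₁ d₂ G)
    (hG : ResidualLE d₁ d₂ G A B) (u : Fin n₁) :
    (#{f ∈ H \ G | (u, f.2) ∈ H} : ℝ) ≤ d₁ * B := by
  rw [mem_extensions] at hH
  rw [card_eq_sum_card_fiberwise (f := Prod.snd) (t := {y | (u, y) ∈ H})
    (by intro f; simp)]
  push_cast
  have : ∀ y ∈ ({y | (u, y) ∈ H} : Finset (Fin n₂)),
      (#{f ∈ {f ∈ H \ G | (u, f.2) ∈ H} | f.2 = y} : ℝ) ≤ B := by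
    intro y _
    refine le_trans ?_ (hG.2 y)
    rw [← hH.1.2 y, ← degRight_sdiff hH.2]
    exact_mod_cast card_le_card (filter_subset_filter _ (filter_subset _ _))
  refine (sum_le_sum this).trans ?_
  rw [sum_const, card_filter_left, hH.1.1, nsmul_eq_mul]

lemma card_sdiff_extensions {G H : BipGraph n₁ n₂} (hH : H ∈ extensions d₁ d₂ G) :
    (#(H \ G) : ℝ) = n₁ * d₁ - #G := by
  rw [mem_extensions] at hH
  rw [card_sdiff_of_subset hH.2, Nat.cast_sub (card_le_card hH.2), hH.1.card_eq]
  push_cast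
  ring

/-- An edge outside `G` belongs to few biregular extensions of `G`. -/
lemma card_extensions_insert_le {G : BipGraph n₁ n₂} {e : Fin n₁ × Fin n₂} (he : e ∉ G) {A B T : ℝ}
    (hG : ResidualLE d₁ d₂ G A B) (hA : 0 ≤ A) (hT : 0 < T)
    (hT' : T ≤ n₁ * d₁ - #G - d₂ * A - d₁ * B) :
    (#(extensions d₁ d₂ (insert e G)) : ℝ) ≤ A * B / T * #(extensions d₁ d₂ G) := by
  have h := congrArg (Nat.cast (R := ℝ)) (card_switch (d₁ := d₁) (d₂ := d₂) he)
  push_cast at h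
  have h1 : (#(extensions d₁ d₂ (insert e G)) : ℝ) * T ≤
      ∑ H ∈ extensions d₁ d₂ (insert e G), (#{f ∈ H \ G | Disjoint (cross e f) H} : ℝ) := by
    rw [← nsmul_eq_mul, ← sum_const]
    refine sum_le_sum fun H hH => ?_
    have hH' : H ∈ extensions d₁ d₂ G := by
      rw [extensions_insert] at hH
      exact (mem_filter.1 hH).1
    have key : #(H \ G) ≤ #{f ∈ H \ G | Disjoint (cross e f) H} +
        #{f ∈ H \ G | (f.1, e.2) ∈ H} + #{f ∈ H \ G | (e.1, f.2) ∈ H} := by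
      refine (card_le_card ?_).trans ((card_union_le _ _).trans
        (Nat.add_le_add_right (card_union_le _ _) _))
      intro f hf
      simp only [mem_union, mem_filter, hf, true_and, cross, disjoint_insert_left,
        disjoint_singleton_left]
      tauto
    have key' : (#(H \ G) : ℝ) ≤ #{f ∈ H \ G | Disjoint (cross e f) H} +
        #{f ∈ H \ G | (f.1, e.2) ∈ H} + #{f ∈ H \ G | (e.1, f.2) ∈ H} := by exact_mod_cast key
    have := card_filter_left_adj_le hH' hG e.2
    have := card_filter_right_adj_le hH' hG e.1
    rw [card_sdiff_extensions hH'] at key'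
    linarith
  have h2 : ∑ H ∈ extensions d₁ d₂ G with e ∉ H, (#{f | f ∉ H ∧ cross e f ⊆ H \ G} : ℝ) ≤
      #(extensions d₁ d₂ G) * (A * B) := by
    rw [← nsmul_eq_mul, ← sum_const]
    refine (sum_le_sum_of_subset_of_nonneg (filter_subset _ _) fun _ _ _ => by positivity).trans ?_
    refine sum_le_sum fun H hH => ?_
    have hH' := mem_extensions.1 hH
    have : #{f | f ∉ H ∧ cross e f ⊆ H \ G} ≤ (H \ G).degLeft e.1 * (H \ G).degRight e.2 := by
      rw [← card_filter_cross_subset]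
      refine card_le_card fun f hf => ?_
      simp only [mem_filter, mem_univ, true_and] at hf ⊢
      exact hf.2
    have h3 : (#{f | f ∉ H ∧ cross e f ⊆ H \ G} : ℝ) ≤
      (H \ G).degLeft e.1 * (H \ G).degRight e.2 := by exact_mod_cast this
    refine h3.trans (mul_le_mul ?_ ?_ (by positivity) hA)
    · rw [degLeft_sdiff hH'.2, hH'.1.1]
      exact hG.1 _
    · rw [degRight_sdiff hH'.2, hH'.1.2]
      exact hG.2 _
  rw [div_mul_eq_mul_div, le_div_iff₀ hT]
  linarith

/-- An edge outside `G` belongs to nearly as many biregular extensions of `G` as the residual degrees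
of its end points suggest. The error term accounts for the pairs of edges at its end points that
cannot be switched because they already lie in a cycle of length four, apart from `e`. -/
lemma le_card_extensions_insert {G : BipGraph n₁ n₂} {e : Fin n₁ × Fin n₂} (he : e ∉ G)
    {A B T : ℝ} (hG : ResidualLE d₁ d₂ G A B) (hA : 0 ≤ A) (hB : 0 ≤ B) (hT : 0 < T)
    (hT' : T ≤ n₁ * d₁ - #G - 2 - d₂ * A - d₁ * B) :
    ((d₁ : ℝ) - G.degLeft e.1) * (d₂ - G.degRight e.2) *
        (#(extensions d₁ d₂ G) - #(extensions d₁ d₂ (insert e G))) ≤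
      #(extensions d₁ d₂ (insert e G)) * (n₁ * d₁ - #G) +
        (#G * (A * B / T) ^ 2 + n₁ * n₂ * (A * B / T) ^ 3) * #(extensions d₁ d₂ G) := by
  set U := A * B / T with hU
  have hU0 : 0 ≤ U := by positivity
  have step : ∀ (K : BipGraph n₁ n₂) (g : Fin n₁ × Fin n₂), G ⊆ K → #K ≤ #G + 2 → g ∉ K →
      (#(extensions d₁ d₂ (insert g K)) : ℝ) ≤ U * #(extensions d₁ d₂ K) := by
    intro K g hGK hK hg
    have hK' : (#K : ℝ) ≤ #G + 2 := by exact_mod_cast hK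
    exact card_extensions_insert_le hg (hG.mono hGK) hA hT (by linarith)
  have h := congrArg (Nat.cast (R := ℝ)) (card_switch (d₁ := d₁) (d₂ := d₂) he)
  push_cast at h
  have h1 : ∑ H ∈ extensions d₁ d₂ (insert e G), (#{f ∈ H \ G | Disjoint (cross e f) H} : ℝ) ≤
      #(extensions d₁ d₂ (insert e G)) * (n₁ * d₁ - #G) := by
    rw [← nsmul_eq_mul, ← sum_const]
    refine sum_le_sum fun H hH => ?_
    rw [extensions_insert, mem_filter] at hH
    rw [← card_sdiff_extensions hH.1]
    exact_mod_cast card_filter_le _ _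
  have h2 : ((d₁ : ℝ) - G.degLeft e.1) * (d₂ - G.degRight e.2) *
        (#(extensions d₁ d₂ G) - #(extensions d₁ d₂ (insert e G))) =
      ∑ H ∈ extensions d₁ d₂ G with e ∉ H, (#{f | f ∉ H ∧ cross e f ⊆ H \ G} : ℝ) +
      ∑ H ∈ extensions d₁ d₂ G with e ∉ H, (#{f | f ∈ H ∧ cross e f ⊆ H \ G} : ℝ) := by
    have hc : (#(extensions d₁ d₂ G) : ℝ) - #(extensions d₁ d₂ (insert e G)) =
        #{H ∈ extensions d₁ d₂ G | e ∉ H} := by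
      rw [extensions_insert, sub_eq_iff_eq_add', ← card_filter_add_card_filter_not (e ∈ ·)]
      push_cast
      rfl
    rw [hc, ← sum_add_distrib, mul_comm, ← nsmul_eq_mul, ← sum_const]
    refine sum_congr rfl fun H hH => ?_
    have hH' := mem_extensions.1 (mem_filter.1 hH).1
    have : (H \ G).degLeft e.1 * (H \ G).degRight e.2 =
        #{f | f ∉ H ∧ cross e f ⊆ H \ G} + #{f | f ∈ H ∧ cross e f ⊆ H \ G} := by
      rw [← card_filter_cross_subset, ← card_filter_add_card_filter_not (· ∉ H), filter_filter,
        filter_filter]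
      simp only [not_not, and_comm]
    rw [← hH'.1.1 e.1, ← hH'.1.2 e.2, ← degLeft_sdiff hH'.2, ← degRight_sdiff hH'.2]
    exact_mod_cast this
  have h3 : ∑ H ∈ extensions d₁ d₂ G with e ∉ H, (#{f | f ∈ H ∧ cross e f ⊆ H \ G} : ℝ) ≤
      (#G * U ^ 2 + n₁ * n₂ * U ^ 3) * #(extensions d₁ d₂ G) := by
    have swap : ∑ H ∈ extensions d₁ d₂ G with e ∉ H, (#{f | f ∈ H ∧ cross e f ⊆ H \ G} : ℝ) =
        ∑ f, (#{H ∈ extensions d₁ d₂ G | e ∉ H ∧ f ∈ H ∧ cross e f ⊆ H \ G} : ℝ) := by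
      have := sum_card_bipartiteAbove_eq_sum_card_bipartiteBelow
        (s := {H ∈ extensions d₁ d₂ G | e ∉ H}) (t := univ)
        (fun H f => f ∈ H ∧ cross e f ⊆ H \ G)
      simp only [bipartiteAbove, bipartiteBelow, filter_filter] at this
      exact_mod_cast this
    have each : ∀ f, (#{H ∈ extensions d₁ d₂ G | e ∉ H ∧ f ∈ H ∧ cross e f ⊆ H \ G} : ℝ) ≤
        ((if f ∈ G then U ^ 2 else 0) + U ^ 3) * #(extensions d₁ d₂ G) := by
      intro f
      rcases eq_empty_or_nonempty {H ∈ extensions d₁ d₂ G | e ∉ H ∧ f ∈ H ∧ cross e f ⊆ H \ G}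
        with hemp | ⟨H₀, hH₀⟩
      · rw [hemp]
        simp only [card_empty, Nat.cast_zero]
        split_ifs <;> positivity
      obtain ⟨hext, heH, hfH, hc⟩ := mem_filter.1 hH₀
      have hc1 : (e.1, f.2) ∈ H₀ \ G := hc (by simp [cross])
      have hc2 : (f.1, e.2) ∈ H₀ \ G := hc (by simp [cross])
      rw [Finset.mem_sdiff] at hc1 hc2
      have h₁ : f.1 ≠ e.1 := fun h => heH (by rw [h] at hc2; exact hc2.1)
      have h₂ : f.2 ≠ e.2 := fun h => heH (by rw [h] at hc1; exact hc1.1)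
      set K₁ := insert (e.1, f.2) G with hK₁
      set K₂ := insert (f.1, e.2) K₁ with hK₂
      have n2 : (f.1, e.2) ∉ K₁ := by simp [hK₁, h₁, hc2.2]
      have c1 : #K₁ = #G + 1 := card_insert_of_notMem hc1.2
      have c2 : #K₂ = #G + 2 := by rw [card_insert_of_notMem n2, c1]
      have g1 : G ⊆ K₁ := subset_insert _ _
      have g2 : G ⊆ K₂ := g1.trans (subset_insert _ _)
      have b1 := step G (e.1, f.2) Subset.rfl (by omega) hc1.2
      have b2 := step K₁ (f.1, e.2) g1 (by omega) n2
      have b12 : (#(extensions d₁ d₂ K₂) : ℝ) ≤ U ^ 2 * #(extensions d₁ d₂ G) := by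
        refine b2.trans ((mul_le_mul_of_nonneg_left b1 hU0).trans_eq ?_)
        ring
      by_cases hf : f ∈ G
      · have sub : {H ∈ extensions d₁ d₂ G | e ∉ H ∧ f ∈ H ∧ cross e f ⊆ H \ G} ⊆
            extensions d₁ d₂ K₂ := by
          intro H hH
          simp only [mem_filter, mem_extensions, cross, insert_subset_iff, Finset.mem_sdiff,
            singleton_subset_iff, hK₁, hK₂] at hH ⊢
          tauto
        have : (#{H ∈ extensions d₁ d₂ G | e ∉ H ∧ f ∈ H ∧ cross e f ⊆ H \ G} : ℝ) ≤
          #(extensions d₁ d₂ K₂) := by exact_mod_cast card_le_card sub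
        rw [if_pos hf, add_mul]
        have : 0 ≤ U ^ 3 * #(extensions d₁ d₂ G) := by positivity
        linarith
      · have sub : {H ∈ extensions d₁ d₂ G | e ∉ H ∧ f ∈ H ∧ cross e f ⊆ H \ G} ⊆
            extensions d₁ d₂ (insert f K₂) := by
          intro H hH
          simp only [mem_filter, mem_extensions, cross, insert_subset_iff, Finset.mem_sdiff,
            singleton_subset_iff, hK₁, hK₂] at hH ⊢
          tauto
        have n3 : f ∉ K₂ := by
          simp only [hK₁, hK₂, mem_insert, Prod.ext_iff, hf]
          tauto
        have b3 := step K₂ f g2 (by omega) n3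
        have : (#{H ∈ extensions d₁ d₂ G | e ∉ H ∧ f ∈ H ∧ cross e f ⊆ H \ G} : ℝ) ≤
          #(extensions d₁ d₂ (insert f K₂)) := by exact_mod_cast card_le_card sub
        rw [if_neg hf, zero_add]
        refine this.trans (b3.trans ((mul_le_mul_of_nonneg_left b12 hU0).trans_eq ?_))
        ring
    rw [swap]
    refine (sum_le_sum fun f _ => each f).trans_eq ?_
    rw [← sum_mul, sum_add_distrib, sum_ite_mem]
    simp
  rw [h2, h]
  exact add_le_add h1 h3

end BipGraph

/-! ### Concentration of the hypergeometric distribution -/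

namespace Finset

variable {α : Type*} [DecidableEq α]

lemma choose_sub_mul_pow_le {m k j : ℕ} (hj : j ≤ k) (hk : k ≤ m) :
    (m - j).choose (k - j) * m ^ j ≤ m.choose k * k ^ j := by
  induction j with
  | zero => simp
  | succ j ih =>
    have ih := ih (by omega)
    obtain ⟨a, rfl⟩ : ∃ a, k = a + 1 + j := ⟨k - 1 - j, by omega⟩
    obtain ⟨b, rfl⟩ : ∃ b, m = b + 1 + j := ⟨m - 1 - j, by omega⟩
    rw [show b + 1 + j - (j + 1) = b by omega, show a + 1 + j - (j + 1) = a by omega]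
    rw [Nat.add_sub_cancel, Nat.add_sub_cancel] at ih
    have h := Nat.add_one_mul_choose_eq b a
    have h1 : (a + 1) * (b + 1 + j) ≤ (b + 1) * (a + 1 + j) := by nlinarith
    refine le_of_mul_le_mul_left ?_ (Nat.succ_pos b)
    rw [Nat.succ_eq_add_one]
    calc (b + 1) * (b.choose a * (b + 1 + j) ^ (j + 1))
        = ((b + 1).choose (a + 1) * (b + 1 + j) ^ j) * ((a + 1) * (b + 1 + j)) := by
          rw [pow_succ]
          linear_combination (b + 1 + j) ^ j * (b + 1 + j) * h
      _ ≤ ((b + 1 + j).choose (a + 1 + j) * (a + 1 + j) ^ j) * ((b + 1) * (a + 1 + j)) :=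
          Nat.mul_le_mul ih h1
      _ = _ := by ring

/-- The probability that a uniform `k`-subset of `E` contains `T` is at most `(k / #E) ^ #T`. -/
lemma card_filter_superset_le {E T : Finset α} {k : ℕ} (hT : T ⊆ E) (hk : k ≤ #E)
    (hE : 0 < #E) :
    (#{X ∈ powersetCard k E | T ⊆ X} : ℝ) ≤ (#E).choose k * ((k : ℝ) / #E) ^ #T := by
  by_cases hTk : #T ≤ k
  · rw [card_filter_powersetCard_subset T E k hT hTk, div_pow, ← mul_div_assoc,
      le_div_iff₀ (by positivity)]
    exact_mod_cast choose_sub_mul_pow_le hTk hk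
  · have : {X ∈ powersetCard k E | T ⊆ X} = ∅ := by
      refine filter_eq_empty_iff.2 fun X hX h => hTk ?_
      exact (card_le_card h).trans_eq (mem_powersetCard.1 hX).2
    rw [this]
    simp only [card_empty, Nat.cast_zero]
    positivity

lemma sum_pow_card_inter_le {E D : Finset α} {k : ℕ} (hD : D ⊆ E) (hk : k ≤ #E) (hE : 0 < #E)
    {s : ℝ} (hs : 0 ≤ s) :
    ∑ X ∈ powersetCard k E, (s + 1) ^ #(X ∩ D) ≤
      (#E).choose k * (s * ((k : ℝ) / #E) + 1) ^ #D := by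
  have expand : ∀ X : Finset α, (s + 1) ^ #(X ∩ D) =
      ∑ T ∈ D.powerset, if T ⊆ X then s ^ #T else 0 := by
    intro X
    rw [← sum_filter, ← sum_pow_mul_eq_add_pow]
    simp only [one_pow, mul_one]
    refine sum_congr ?_ fun _ _ => rfl
    ext T
    rw [mem_powerset, mem_filter, mem_powerset, subset_inter_iff, and_comm]
  calc ∑ X ∈ powersetCard k E, (s + 1) ^ #(X ∩ D)
      = ∑ T ∈ D.powerset, s ^ #T * #{X ∈ powersetCard k E | T ⊆ X} := by
        simp only [expand]
        rw [sum_comm]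
        refine sum_congr rfl fun T _ => ?_
        rw [← sum_filter, sum_const, nsmul_eq_mul, mul_comm]
    _ ≤ ∑ T ∈ D.powerset, s ^ #T * ((#E).choose k * ((k : ℝ) / #E) ^ #T) := by
        refine sum_le_sum fun T hT => ?_
        gcongr
        exact card_filter_superset_le ((mem_powerset.1 hT).trans hD) hk hE
    _ = (#E).choose k * (s * ((k : ℝ) / #E) + 1) ^ #D := by
        rw [← sum_pow_mul_eq_add_pow, mul_sum]
        refine sum_congr rfl fun T _ => ?_
        rw [mul_pow, one_pow]
        ring

lemma sum_pow_card_sdiff_le {E D : Finset α} {k : ℕ} (hD : D ⊆ E) (hk : k ≤ #E) (hE : 0 < #E)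
    {s : ℝ} (hs : 0 ≤ s) :
    ∑ X ∈ powersetCard k E, (s + 1) ^ #(D \ X) ≤
      (#E).choose k * (s * (((#E - k : ℕ) : ℝ) / #E) + 1) ^ #D := by
  have h := sum_pow_card_inter_le hD (Nat.sub_le (#E) k) hE hs
  rw [Nat.choose_symm hk] at h
  refine le_trans (le_of_eq ?_) h
  refine sum_nbij' (E \ ·) (E \ ·) ?_ ?_ ?_ ?_ ?_
  · intro X hX
    rw [mem_powersetCard] at hX ⊢
    exact ⟨sdiff_subset, by rw [card_sdiff_of_subset hX.1, hX.2]⟩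
  · intro X hX
    rw [mem_powersetCard] at hX ⊢
    exact ⟨sdiff_subset, by rw [card_sdiff_of_subset hX.1, hX.2]; omega⟩
  · intro X hX
    exact sdiff_sdiff_eq_self (mem_powersetCard.1 hX).1
  · intro X hX
    exact sdiff_sdiff_eq_self (mem_powersetCard.1 hX).1
  · intro X _
    congr 2
    ext a
    simp only [Finset.mem_sdiff, mem_inter]
    exact ⟨fun h => ⟨⟨hD h.1, h.2⟩, h.1⟩, fun h => ⟨h.2, h.1.2⟩⟩

/-- The exponential moments of the number of elements of `D` missed by a uniform `k`-subset of `E`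
are at most those of a binomial variable with the same mean. -/
lemma sum_exp_card_sdiff_le {E D : Finset α} {k : ℕ} (hD : D ⊆ E) (hk : k ≤ #E) (hE : 0 < #E)
    {l : ℝ} (hl : |l| ≤ 1) :
    ∑ X ∈ powersetCard k E, Real.exp (l * #(D \ X)) ≤
      (#E).choose k * Real.exp ((1 - (k : ℝ) / #E) * #D * (l + l ^ 2)) := by
  have hE' : (0 : ℝ) < #E := by exact_mod_cast hE
  have hq : ((#E - k : ℕ) : ℝ) / #E = 1 - (k : ℝ) / #E := by
    rw [Nat.cast_sub hk]
    field_simp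
  have hτ : 0 ≤ 1 - (k : ℝ) / #E := by rw [← hq]; positivity
  have hτ1 : 0 ≤ (k : ℝ) / #E := by positivity
  set τ := 1 - (k : ℝ) / #E with hτd
  have main : ∑ X ∈ powersetCard k E, Real.exp (l * #(D \ X)) ≤
      (#E).choose k * ((Real.exp l - 1) * τ + 1) ^ #D := by
    rcases le_total 0 l with h0 | h0
    · have h := sum_pow_card_sdiff_le hD hk hE (s := Real.exp l - 1) (by
        have := Real.add_one_le_exp l
        linarith)
      rw [hq, sub_add_cancel] at h
      simp only [← Real.exp_nat_mul] at h
      simpa only [mul_comm l] using h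
    · have h := sum_pow_card_inter_le hD hk hE (s := Real.exp (-l) - 1) (by
        have := Real.add_one_le_exp (-l)
        linarith)
      rw [sub_add_cancel] at h
      simp only [← Real.exp_nat_mul] at h
      have e : ∀ X, Real.exp (l * #(D \ X)) = Real.exp l ^ #D * Real.exp (#(X ∩ D) * -l) := by
        intro X
        rw [← Real.exp_nat_mul, ← Real.exp_add]
        congr 1
        have : (#D : ℝ) = #(D \ X) + #(X ∩ D) := by
          rw [inter_comm]
          exact_mod_cast (card_sdiff_add_card_inter D X).symm
        rw [this]
        ring
      simp only [e]
      rw [← mul_sum]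
      refine (mul_le_mul_of_nonneg_left h (by positivity)).trans_eq ?_
      rw [mul_left_comm, ← mul_pow]
      congr 2
      have : Real.exp l * Real.exp (-l) = 1 := by rw [← Real.exp_add]; simp
      linear_combination ((k : ℝ) / #E) * this
  refine main.trans ?_
  gcongr
  have h1 : Real.exp l - 1 ≤ l + l ^ 2 := by
    have := (abs_le.1 (Real.abs_exp_sub_one_sub_id_le hl)).2
    linarith
  have h2 : (Real.exp l - 1) * τ + 1 ≤ Real.exp (τ * (l + l ^ 2)) := by
    have := Real.add_one_le_exp (τ * (l + l ^ 2))
    nlinarith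
  have h3 : 0 ≤ (Real.exp l - 1) * τ + 1 := by
    have := Real.exp_pos l
    nlinarith
  refine (pow_le_pow_left₀ h3 h2 _).trans_eq ?_
  rw [← Real.exp_nat_mul]
  congr 1
  ring

/-- Chernoff bound for the number of elements of `D` missed by a uniform `k`-subset of `E`. -/
lemma card_filter_card_sdiff_deviation_le {E D : Finset α} {k : ℕ} (hD : D ⊆ E) (hk : k ≤ #E)
    (hE : 0 < #E) {δ : ℝ} (h0 : 0 ≤ δ) (h1 : δ ≤ 1) :
    (#{X ∈ powersetCard k E | δ * ((1 - (k : ℝ) / #E) * #D) <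
        |(#(D \ X) : ℝ) - (1 - (k : ℝ) / #E) * #D|} : ℝ) ≤
      (#E).choose k * (2 * Real.exp (-((1 - (k : ℝ) / #E) * #D * δ ^ 2 / 4))) := by
  set a := (1 - (k : ℝ) / #E) * #D with ha
  have b1 := sum_exp_card_sdiff_le hD hk hE (l := δ / 2) (by rw [abs_of_nonneg] <;> linarith)
  have b2 := sum_exp_card_sdiff_le hD hk hE (l := -(δ / 2))
    (by rw [abs_neg, abs_of_nonneg] <;> linarith)
  rw [← ha] at b1 b2
  calc (#{X ∈ powersetCard k E | δ * a < |(#(D \ X) : ℝ) - a|} : ℝ)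
      ≤ ∑ X ∈ powersetCard k E, (Real.exp (-(δ / 2 * ((1 + δ) * a))) *
          Real.exp (δ / 2 * #(D \ X)) +
          Real.exp (δ / 2 * ((1 - δ) * a)) * Real.exp (-(δ / 2) * #(D \ X))) := by
        rw [card_filter]
        push_cast
        refine sum_le_sum fun X _ => ?_
        rw [← Real.exp_add, ← Real.exp_add]
        split_ifs with h
        · rcases lt_abs.1 h with h | h
          · have : 1 ≤ Real.exp (-(δ / 2 * ((1 + δ) * a)) + δ / 2 * #(D \ X)) :=
              Real.one_le_exp (by nlinarith)
            have := Real.exp_pos (δ / 2 * ((1 - δ) * a) + -(δ / 2) * #(D \ X))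
            linarith
          · have : 1 ≤ Real.exp (δ / 2 * ((1 - δ) * a) + -(δ / 2) * #(D \ X)) :=
              Real.one_le_exp (by nlinarith)
            have := Real.exp_pos (-(δ / 2 * ((1 + δ) * a)) + δ / 2 * #(D \ X))
            linarith
        · positivity
    _ ≤ Real.exp (-(δ / 2 * ((1 + δ) * a))) *
          ((#E).choose k * Real.exp (a * (δ / 2 + (δ / 2) ^ 2))) +
        Real.exp (δ / 2 * ((1 - δ) * a)) *
          ((#E).choose k * Real.exp (a * (-(δ / 2) + (-(δ / 2)) ^ 2))) := by
        rw [sum_add_distrib, ← mul_sum, ← mul_sum]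
        gcongr
    _ = (#E).choose k * (2 * Real.exp (-(a * δ ^ 2 / 4))) := by
        rw [mul_left_comm, ← Real.exp_add, mul_left_comm (Real.exp _), ← Real.exp_add,
          show -(δ / 2 * ((1 + δ) * a)) + a * (δ / 2 + (δ / 2) ^ 2) = -(a * δ ^ 2 / 4) by ring,
          show δ / 2 * ((1 - δ) * a) + a * (-(δ / 2) + (-(δ / 2)) ^ 2) = -(a * δ ^ 2 / 4) by ring]
        ring

end Finset

/-! ### The residual degrees of a random part of a biregular graph -/

namespace BipGraph

variable {n₁ n₂ d₁ d₂ : ℕ}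

/-- Every residual degree of `G` is within a factor `1 ± δ` of the share of `d₁` or `d₂` that
corresponds to the proportion `1 - #G / m` of missing edges, where `m = n₁ d₁`. -/
def Balanced (d₁ d₂ : ℕ) (δ : ℝ) (G : BipGraph n₁ n₂) : Prop :=
  (∀ u, |((d₁ : ℝ) - G.degLeft u) - (1 - (#G : ℝ) / ((n₁ * d₁ : ℕ) : ℝ)) * d₁| ≤
      δ * ((1 - (#G : ℝ) / ((n₁ * d₁ : ℕ) : ℝ)) * d₁)) ∧
    ∀ v, |((d₂ : ℝ) - G.degRight v) - (1 - (#G : ℝ) / ((n₁ * d₁ : ℕ) : ℝ)) * d₂| ≤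
      δ * ((1 - (#G : ℝ) / ((n₁ * d₁ : ℕ) : ℝ)) * d₂)

open Classical in
lemma card_filter_not_balanced_le {H : BipGraph n₁ n₂} (hH : H.IsBiregular d₁ d₂) {t : ℕ}
    (ht : t ≤ n₁ * d₁) (hm : 0 < n₁ * d₁) {δ β : ℝ} (h0 : 0 ≤ δ) (h1 : δ ≤ 1)
    (hβ₁ : Real.exp (-((1 - (t : ℝ) / ((n₁ * d₁ : ℕ) : ℝ)) * d₁ * δ ^ 2 / 4)) ≤ β)
    (hβ₂ : Real.exp (-((1 - (t : ℝ) / ((n₁ * d₁ : ℕ) : ℝ)) * d₂ * δ ^ 2 / 4)) ≤ β) :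
    (#{G ∈ powersetCard t H | ¬ Balanced d₁ d₂ δ G} : ℝ) ≤
      (n₁ * d₁).choose t * ((n₁ + n₂) * (2 * β)) := by
  have hE := hH.card_eq
  set L : Fin n₁ → Finset (BipGraph n₁ n₂) := fun u => {G ∈ powersetCard t H |
    δ * ((1 - (t : ℝ) / #H) * #(H.filter (·.1 = u))) <
      |(#(H.filter (·.1 = u) \ G) : ℝ) - (1 - (t : ℝ) / #H) * #(H.filter (·.1 = u))|} with hL
  set R : Fin n₂ → Finset (BipGraph n₁ n₂) := fun v => {G ∈ powersetCard t H |
    δ * ((1 - (t : ℝ) / #H) * #(H.filter (·.2 = v))) <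
      |(#(H.filter (·.2 = v) \ G) : ℝ) - (1 - (t : ℝ) / #H) * #(H.filter (·.2 = v))|} with hR
  have dl : ∀ u, #(H.filter (·.1 = u)) = d₁ := hH.1
  have dr : ∀ v, #(H.filter (·.2 = v)) = d₂ := hH.2
  have sub : {G ∈ powersetCard t H | ¬ Balanced d₁ d₂ δ G} ⊆ univ.biUnion L ∪ univ.biUnion R := by
    intro G hG
    rw [mem_filter] at hG
    obtain ⟨hG, hb⟩ := hG
    have hG' := mem_powersetCard.1 hG
    have el : ∀ u, (#(H.filter (·.1 = u) \ G) : ℝ) = d₁ - G.degLeft u := by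
      intro u
      rw [← hH.1 u, ← degLeft_sdiff hG'.1, degLeft]
      congr 2
      ext e
      simp only [Finset.mem_sdiff, mem_filter]
      tauto
    have er : ∀ v, (#(H.filter (·.2 = v) \ G) : ℝ) = d₂ - G.degRight v := by
      intro v
      rw [← hH.2 v, ← degRight_sdiff hG'.1, degRight]
      congr 2
      ext e
      simp only [Finset.mem_sdiff, mem_filter]
      tauto
    simp only [hL, hR, mem_union, mem_biUnion, mem_univ, true_and, mem_filter, hG, dl, dr, el, er,
      hE]
    by_contra hcon
    push Not at hcon
    refine hb ⟨fun u => ?_, fun v => ?_⟩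
    · rw [hG'.2]
      exact hcon.1 u
    · rw [hG'.2]
      exact hcon.2 v
  have bl : ∀ u, (#(L u) : ℝ) ≤ (n₁ * d₁).choose t * (2 * β) := by
    intro u
    have := card_filter_card_sdiff_deviation_le (filter_subset (·.1 = u) H) (hE.symm ▸ ht)
      (hE.symm ▸ hm) h0 h1
    refine this.trans ?_
    rw [dl, hE]
    gcongr
  have br : ∀ v, (#(R v) : ℝ) ≤ (n₁ * d₁).choose t * (2 * β) := by
    intro v
    have := card_filter_card_sdiff_deviation_le (filter_subset (·.2 = v) H) (hE.symm ▸ ht)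
      (hE.symm ▸ hm) h0 h1
    refine this.trans ?_
    rw [dr, hE]
    gcongr
  have c1 : #{G ∈ powersetCard t H | ¬ Balanced d₁ d₂ δ G} ≤ ∑ u, #(L u) + ∑ v, #(R v) :=
    (card_le_card sub).trans ((card_union_le _ _).trans
      (add_le_add card_biUnion_le card_biUnion_le))
  have c2 : (#{G ∈ powersetCard t H | ¬ Balanced d₁ d₂ δ G} : ℝ) ≤
    ∑ u, (#(L u) : ℝ) + ∑ v, (#(R v) : ℝ) := by exact_mod_cast c1
  refine c2.trans ((add_le_add (sum_le_sum fun u _ => bl u)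
    (sum_le_sum fun v _ => br v)).trans_eq ?_)
  simp
  ring

/-- The arithmetic behind `Balanced.le_card_extensions_insert`. -/
lemma switching_ratio_bound {m p τ δ ε r r' g N ab : ℝ} (hm : 0 < m) (hp0 : 0 < p)
    (hp : p ≤ 1 / 16) (hτ0 : 0 < τ) (hτ1 : τ ≤ 1) (h0 : 0 ≤ δ)
    (hε : 2 * δ + 584 * p ≤ ε) (hr0 : 0 ≤ r) (hg : g ≤ m) (hN : N * p = m)
    (hab : (1 - δ) ^ 2 * (τ ^ 2 * (p * m)) ≤ ab) (up : r' ≤ 8 * τ * p * r)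
    (low : ab * (r - r') ≤ r' * (τ * m) + (g * (8 * τ * p) ^ 2 + N * (8 * τ * p) ^ 3) * r) :
    τ * p * (1 - ε) * r ≤ r' := by
  have hrr : (1 - 8 * p) * r ≤ r - r' := by
    have : 8 * τ * p * r ≤ 8 * 1 * p * r := by gcongr
    linarith
  have hrr0 : 0 ≤ (1 - 8 * p) * r := mul_nonneg (by linarith) hr0
  have hA : (1 - δ) ^ 2 * (τ ^ 2 * (p * m)) * ((1 - 8 * p) * r) ≤ ab * (r - r') :=
    mul_le_mul hab hrr hrr0 (le_trans (by positivity) hab)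
  have hB : (g * (8 * τ * p) ^ 2 + N * (8 * τ * p) ^ 3) * r ≤
      τ ^ 2 * (p * m) * (576 * p) * r := by
    refine mul_le_mul_of_nonneg_right ?_ hr0
    have e1 : g * (8 * τ * p) ^ 2 ≤ m * (8 * τ * p) ^ 2 := by gcongr
    have e2 : N * (8 * τ * p) ^ 3 = 512 * τ ^ 2 * p ^ 2 * m * τ := by
      linear_combination 512 * τ ^ 3 * p ^ 2 * hN
    have e3 : 512 * τ ^ 2 * p ^ 2 * m * τ ≤ 512 * τ ^ 2 * p ^ 2 * m * 1 := by gcongr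
    linarith
  have hC : 1 - ε ≤ (1 - δ) ^ 2 * (1 - 8 * p) - 576 * p := by
    have e1 : 0 ≤ δ * p := by positivity
    have e2 : 0 ≤ δ ^ 2 * (1 - 8 * p) := mul_nonneg (sq_nonneg δ) (by linarith)
    linarith
  have hD : τ ^ 2 * (p * m) * r * (1 - ε) ≤
      τ ^ 2 * (p * m) * r * ((1 - δ) ^ 2 * (1 - 8 * p) - 576 * p) := by gcongr
  refine le_of_mul_le_mul_right ?_ (mul_pos hτ0 hm)
  linarith

/-- From a balanced graph `G`, every new edge is nearly as likely to belong to a random biregular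
extension as the edge density predicts. -/
lemma Balanced.le_card_extensions_insert {G : BipGraph n₁ n₂} {δ ε : ℝ}
    (hG : Balanced d₁ d₂ δ G) (hm : n₁ * d₁ = n₂ * d₂) (hn₁ : 0 < n₁) (hn₂ : 0 < n₂)
    (hd₁ : 0 < d₁) (hd₂ : 0 < d₂) (h0 : 0 ≤ δ) (h1 : δ ≤ 1)
    (hp : (d₁ : ℝ) * d₂ / ((n₁ * d₁ : ℕ) : ℝ) ≤ 1 / 16)
    (hM : (8 : ℝ) ≤ ((n₁ * d₁ : ℕ) : ℝ) - #G)
    (hε : 2 * δ + 584 * ((d₁ : ℝ) * d₂ / ((n₁ * d₁ : ℕ) : ℝ)) ≤ ε)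
    {e : Fin n₁ × Fin n₂} (he : e ∉ G) :
    (1 - ε) / ((n₁ * n₂ : ℕ) : ℝ) * ((((n₁ * d₁ : ℕ) : ℝ) - #G) * #(extensions d₁ d₂ G)) ≤
      #(extensions d₁ d₂ (insert e G)) := by
  set m : ℝ := ((n₁ * d₁ : ℕ) : ℝ) with hmdef
  set p : ℝ := (d₁ : ℝ) * d₂ / m with hpdef
  set r : ℝ := (#(extensions d₁ d₂ G) : ℝ) with hr
  set r' : ℝ := (#(extensions d₁ d₂ (insert e G)) : ℝ) with hr'
  have hr0 : 0 ≤ r := by positivity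
  have hr'0 : 0 ≤ r' := by positivity
  have hm0 : 0 < m := by rw [hmdef]; positivity
  set τ : ℝ := 1 - (#G : ℝ) / m with hτ
  have hMτ : m - #G = τ * m := by rw [hτ]; field_simp
  have hm1 : m = n₁ * d₁ := by rw [hmdef]; push_cast; ring
  have hm2 : m = n₂ * d₂ := by rw [hmdef, hm]; push_cast; ring
  have hdd : (d₁ : ℝ) * d₂ = p * m := by rw [hpdef]; field_simp
  have hp0 : 0 < p := by rw [hpdef]; positivity
  have hN : (n₁ : ℝ) * n₂ * p = m := by
    rw [hpdef, mul_div_assoc', div_eq_iff hm0.ne']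
    nth_rw 1 [hm1]
    rw [hm2]
    ring
  have hτ0 : 0 < τ := by
    by_contra h
    push Not at h
    nlinarith
  have hτ1 : τ ≤ 1 := by
    have : 0 ≤ (#G : ℝ) / m := div_nonneg (Nat.cast_nonneg _) hm0.le
    linarith
  have hres : ResidualLE d₁ d₂ G (2 * τ * d₁) (2 * τ * d₂) := by
    refine ⟨fun u => ?_, fun v => ?_⟩
    · have := (abs_le.1 (hG.1 u)).2
      have : δ * (τ * d₁) ≤ 1 * (τ * d₁) := by gcongr
      linarith
    · have := (abs_le.1 (hG.2 v)).2
      have : δ * (τ * d₂) ≤ 1 * (τ * d₂) := by gcongr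
      linarith
  have hT : 0 < τ * m / 2 := by positivity
  have hpM : p * (τ * m) ≤ 1 / 16 * (τ * m) := by gcongr
  rw [hMτ] at hM
  have hT' : τ * m / 2 ≤ n₁ * d₁ - #G - 2 - d₂ * (2 * τ * d₁) - d₁ * (2 * τ * d₂) := by
    have : d₂ * (2 * τ * d₁) + d₁ * (2 * τ * d₂) = 4 * (p * (τ * m)) := by
      linear_combination 4 * τ * hdd
    rw [← hm1]
    linarith
  have hU : 2 * τ * d₁ * (2 * τ * d₂) / (τ * m / 2) = 8 * τ * p := by
    rw [div_eq_iff hT.ne']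
    linear_combination 4 * τ ^ 2 * hdd
  have up := card_extensions_insert_le he hres (by positivity) hT (by linarith)
  have low := BipGraph.le_card_extensions_insert he hres (by positivity) (by positivity) hT hT'
  rw [hU] at up low
  rw [← hr, ← hr', ← hm1, hMτ] at low
  rw [← hr, ← hr'] at up
  have ha : (1 - δ) * (τ * d₁) ≤ d₁ - G.degLeft e.1 := by
    have := (abs_le.1 (hG.1 e.1)).1
    linarith
  have hb : (1 - δ) * (τ * d₂) ≤ d₂ - G.degRight e.2 := by
    have := (abs_le.1 (hG.2 e.2)).1
    linarith
  have hab : ((1 - δ) * (τ * d₁)) * ((1 - δ) * (τ * d₂)) ≤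
      (d₁ - G.degLeft e.1) * (d₂ - G.degRight e.2) := by
    have : 0 ≤ 1 - δ := by linarith
    exact mul_le_mul ha hb (by positivity) (le_trans (by positivity) ha)
  have hGm : (#G : ℝ) ≤ m := by linarith
  have fin2 : τ * p * (1 - ε) * r ≤ r' :=
    switching_ratio_bound hm0 hp0 hp hτ0 hτ1 h0 hε hr0 hGm hN
      (le_of_eq_of_le (by linear_combination (-(1 - δ) ^ 2 * τ ^ 2) * hdd) hab) up low
  refine le_trans (le_of_eq ?_) fin2
  have hNpos : ((n₁ : ℝ) * n₂) ≠ 0 := by positivity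
  rw [hMτ]
  push_cast
  rw [div_mul_eq_mul_div, div_eq_iff hNpos, ← hN]
  ring

end BipGraph

/-! ### Point masses, mixtures and product couplings -/

namespace FiniteLaw

variable {α β : Type*} [Fintype α]

lemma single_mem [DecidableEq α] (a : α) : (Pi.single a 1 : α → ℝ) ∈ stdSimplex ℝ α :=
  single_mem_stdSimplex ℝ a

lemma single_mix [DecidableEq α] (a : α) (k : α → β → ℝ) : mix (Pi.single a 1) k = k a := by
  ext b
  simp [mix, Pi.single_apply]

lemma sum_mix_mul [Fintype β] (μ : α → ℝ) (k : α → β → ℝ) (f : β → ℝ) :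
    ∑ b, mix μ k b * f b = ∑ a, μ a * ∑ b, k a b * f b := by
  simp only [mix, sum_mul, mul_sum, mul_assoc]
  exact sum_comm

lemma mix_ne_zero {μ : α → ℝ} {k : α → β → ℝ} {b : β} (h : mix μ k b ≠ 0) :
    ∃ a, μ a ≠ 0 ∧ k a b ≠ 0 := by
  obtain ⟨a, -, ha⟩ := exists_ne_zero_of_sum_ne_zero h
  exact ⟨a, left_ne_zero_of_mul ha, right_ne_zero_of_mul ha⟩

lemma couples_of_support [Fintype β] {r : α → β → Prop} {μ : α → ℝ} {ν : β → ℝ}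
    (hμ : μ ∈ stdSimplex ℝ α) (hν : ν ∈ stdSimplex ℝ β)
    (h : ∀ a b, μ a ≠ 0 → ν b ≠ 0 → r a b) : Couples r μ ν 0 := by
  refine couples_of_partial hμ hν (fun x => μ x.1 * ν x.2)
    (fun x => mul_nonneg (hμ.1 _) (hν.1 _)) ?_ ?_ ?_ ?_
  · intro a
    simp only [← mul_sum, hν.2, mul_one, le_refl]
  · intro b
    simp only [← sum_mul, hμ.2, one_mul, le_refl]
  · exact fun a b hab => h a b (left_ne_zero_of_mul hab) (right_ne_zero_of_mul hab)
  · intro a b ha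
    simp only [← mul_sum, hν.2, mul_one, ne_eq, not_true] at ha

lemma eq_of_single_ne_zero {ι : Type*} [DecidableEq ι] {a x : ι} (h : (Pi.single a 1 : ι → ℝ) x ≠ 0) :
    x = a := by
  by_contra hne
  simp [hne] at h

lemma mem_of_unif_ne_zero {ι : Type*} [DecidableEq ι] {s : Finset ι} {a : ι} (h : unif s a ≠ 0) :
    a ∈ s := by
  by_contra hne
  exact h (if_neg hne)

end FiniteLaw

/-! ### The law of a uniformly random part of a random biregular graph -/

namespace BipGraph

open FiniteLaw

variable {n₁ n₂ d₁ d₂ : ℕ}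

/-- The law of a uniform `t`-subset of the edges of a random biregular graph: a graph with `t` edges
has probability proportional to the number of its biregular extensions. -/
noncomputable def prefixLaw (n₁ n₂ d₁ d₂ t : ℕ) (G : BipGraph n₁ n₂) : ℝ :=
  if #G = t then
    (#(extensions d₁ d₂ G) : ℝ) / (#(biregular n₁ n₂ d₁ d₂) * (n₁ * d₁).choose t) else 0

/-- The law of a uniformly random edge outside `G` of a random biregular extension of `G`. -/
noncomputable def nextEdge (d₁ d₂ : ℕ) (G : BipGraph n₁ n₂) (e : Fin n₁ × Fin n₂) : ℝ :=
  if e ∈ G then 0 else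
    (#(extensions d₁ d₂ (insert e G)) : ℝ) /
      ((((n₁ * d₁ : ℕ) : ℝ) - #G) * #(extensions d₁ d₂ G))

lemma extensions_subset_biregular (G : BipGraph n₁ n₂) :
    extensions d₁ d₂ G ⊆ biregular n₁ n₂ d₁ d₂ := filter_subset _ _

lemma sum_card_extensions_insert (G : BipGraph n₁ n₂) :
    ∑ e with e ∉ G, (#(extensions d₁ d₂ (insert e G)) : ℝ) =
      (((n₁ * d₁ : ℕ) : ℝ) - #G) * #(extensions d₁ d₂ G) := by
  have h := sum_card_bipartiteAbove_eq_sum_card_bipartiteBelow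
    (s := ({e | e ∉ G} : Finset (Fin n₁ × Fin n₂))) (t := extensions d₁ d₂ G)
    (fun e H => e ∈ H)
  simp only [bipartiteAbove, bipartiteBelow, ← extensions_insert] at h
  have h' : ∑ e with e ∉ G, (#(extensions d₁ d₂ (insert e G)) : ℝ) =
    ∑ H ∈ extensions d₁ d₂ G, (#{e ∈ ({e | e ∉ G} : Finset (Fin n₁ × Fin n₂)) | e ∈ H} : ℝ) := by
    exact_mod_cast h
  rw [h', mul_comm, ← nsmul_eq_mul, ← sum_const]
  refine sum_congr rfl fun H hH => ?_
  push_cast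
  rw [← card_sdiff_extensions hH]
  congr 2
  ext e
  simp [and_comm]

lemma nextEdge_mem {G : BipGraph n₁ n₂} (hG : (extensions d₁ d₂ G).Nonempty)
    (ht : #G < n₁ * d₁) : nextEdge d₁ d₂ G ∈ stdSimplex ℝ (Fin n₁ × Fin n₂) := by
  have h1 : (0 : ℝ) < ((n₁ * d₁ : ℕ) : ℝ) - #G := by
    rw [sub_pos]
    exact_mod_cast ht
  have h2 : (0 : ℝ) < #(extensions d₁ d₂ G) := by exact_mod_cast hG.card_pos
  constructor
  · intro e
    unfold nextEdge
    split_ifs <;> positivity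
  · have e : ∀ e, nextEdge d₁ d₂ G e = if e ∉ G then
      (#(extensions d₁ d₂ (insert e G)) : ℝ) /
      ((((n₁ * d₁ : ℕ) : ℝ) - #G) * #(extensions d₁ d₂ G)) else 0 := by
      intro e
      simp only [nextEdge, ite_not]
    simp only [e]
    rw [← sum_filter, ← sum_div, sum_card_extensions_insert, div_self (by positivity)]

lemma prefixLaw_ne_zero {t : ℕ} {G : BipGraph n₁ n₂} (h : prefixLaw n₁ n₂ d₁ d₂ t G ≠ 0) :
    #G = t ∧ (extensions d₁ d₂ G).Nonempty := by
  unfold prefixLaw at h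
  split_ifs at h with hc
  · refine ⟨hc, ?_⟩
    rw [nonempty_iff_ne_empty]
    rintro he
    simp [he] at h
  · exact absurd rfl h

lemma prefixLaw_zero (hR : (biregular n₁ n₂ d₁ d₂).Nonempty) :
    prefixLaw n₁ n₂ d₁ d₂ 0 = Pi.single ∅ 1 := by
  have h : (#(biregular n₁ n₂ d₁ d₂) : ℝ) ≠ 0 := by exact_mod_cast hR.card_pos.ne'
  ext G
  unfold prefixLaw
  simp only [card_eq_zero, Pi.single_apply]
  split_ifs with hG
  · subst hG
    simp [extensions, h]
  · rfl

lemma prefixLaw_succ {t : ℕ} (ht : t < n₁ * d₁) :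
    prefixLaw n₁ n₂ d₁ d₂ (t + 1) = mix (prefixLaw n₁ n₂ d₁ d₂ t)
      (fun G => mix (nextEdge d₁ d₂ G) fun e => Pi.single (insert e G) 1) := by
  ext K
  have hmt : (0 : ℝ) < ((n₁ * d₁ : ℕ) : ℝ) - t := by
    rw [sub_pos]
    exact_mod_cast ht
  have hC : (0 : ℝ) < (n₁ * d₁).choose t := by exact_mod_cast Nat.choose_pos ht.le
  have hC' : ((n₁ * d₁).choose (t + 1) : ℝ) * (t + 1) =
      (n₁ * d₁).choose t * (((n₁ * d₁ : ℕ) : ℝ) - t) := by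
    rw [← Nat.cast_sub ht.le]
    exact_mod_cast Nat.choose_succ_right_eq (n₁ * d₁) t
  -- The graph `K` arises only from the graphs `K.erase e` with `e ∈ K`.
  have inner : ∀ e, ∑ G, prefixLaw n₁ n₂ d₁ d₂ t G *
      (nextEdge d₁ d₂ G e * (Pi.single (insert e G) 1 : BipGraph n₁ n₂ → ℝ) K) =
      if e ∈ K then prefixLaw n₁ n₂ d₁ d₂ t (K.erase e) * nextEdge d₁ d₂ (K.erase e) e
        else 0 := by
    intro e
    have vanish : ∀ G, ¬ (e ∈ K ∧ G = K.erase e) → prefixLaw n₁ n₂ d₁ d₂ t G *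
      (nextEdge d₁ d₂ G e * (Pi.single (insert e G) 1 : BipGraph n₁ n₂ → ℝ) K) = 0 := by
      intro G hG
      by_cases he : e ∈ G
      · simp [nextEdge, he]
      · by_cases hK : K = insert e G
        · exact absurd ⟨by simp [hK], by simp [hK, he]⟩ hG
        · simp [hK]
    split_ifs with he
    · rw [sum_eq_single (K.erase e)]
      · simp [insert_erase he]
      · intro G _ hG
        exact vanish G fun h => hG h.2
      · simp
    · exact sum_eq_zero fun G _ => vanish G fun h => he h.1
  have rhs : mix (prefixLaw n₁ n₂ d₁ d₂ t)
      (fun G => mix (nextEdge d₁ d₂ G) fun e => Pi.single (insert e G) 1) K =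
      ∑ e ∈ K, prefixLaw n₁ n₂ d₁ d₂ t (K.erase e) * nextEdge d₁ d₂ (K.erase e) e := by
    simp only [mix, mul_sum]
    rw [sum_comm]
    simp only [inner]
    rw [sum_ite_mem, univ_inter]
  rw [rhs]
  unfold prefixLaw
  split_ifs with hK
  · have each : ∀ e ∈ K, ((if #(K.erase e) = t then (#(extensions d₁ d₂ (K.erase e)) : ℝ) /
        (#(biregular n₁ n₂ d₁ d₂) * (n₁ * d₁).choose t) else 0) * nextEdge d₁ d₂ (K.erase e) e) =
        (#(extensions d₁ d₂ K) : ℝ) / (#(biregular n₁ n₂ d₁ d₂) *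
          ((n₁ * d₁).choose t * (((n₁ * d₁ : ℕ) : ℝ) - t))) := by
      intro e he
      have hc : #(K.erase e) = t := by rw [card_erase_of_mem he, hK]; rfl
      rw [if_pos hc, nextEdge, if_neg (notMem_erase e K), hc, insert_erase he]
      by_cases h0 : #(extensions d₁ d₂ (K.erase e)) = 0
      · have : #(extensions d₁ d₂ K) = 0 := by
          rw [← insert_erase he, extensions_insert]
          rw [card_eq_zero] at h0
          simp [h0]
        simp [this, h0]
      · have : (#(extensions d₁ d₂ (K.erase e)) : ℝ) ≠ 0 := by exact_mod_cast h0
        by_cases hb : (#(biregular n₁ n₂ d₁ d₂) : ℝ) = 0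
        · simp [hb]
        · field_simp
    rw [sum_congr rfl each, sum_const, hK, ← hC', nsmul_eq_mul]
    push_cast
    have ht1 : (t : ℝ) + 1 ≠ 0 := by positivity
    have hC1 : ((n₁ * d₁).choose (t + 1) : ℝ) ≠ 0 := by exact_mod_cast (Nat.choose_pos ht).ne'
    by_cases hb : (#(biregular n₁ n₂ d₁ d₂) : ℝ) = 0
    · simp [hb]
    · field_simp
  · refine (sum_eq_zero fun e he => ?_).symm
    have : #(K.erase e) ≠ t := by
      rw [card_erase_of_mem he]
      have := card_pos.2 ⟨e, he⟩
      omega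
    rw [if_neg this, zero_mul]

lemma prefixLaw_step_mem {t : ℕ} (ht : t < n₁ * d₁) (G : BipGraph n₁ n₂)
    (hG : prefixLaw n₁ n₂ d₁ d₂ t G ≠ 0) :
    mix (nextEdge d₁ d₂ G) (fun e => Pi.single (insert e G) 1) ∈
      stdSimplex ℝ (BipGraph n₁ n₂) := by
  obtain ⟨h1, h2⟩ := prefixLaw_ne_zero hG
  exact mix_mem (nextEdge_mem h2 (h1 ▸ ht)) fun e _ => single_mem _

/-- A sum over graphs with law `prefixLaw` is an average over biregular graphs and their
`t`-subsets. -/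
lemma sum_card_eq_sum_extensions (t : ℕ) (f : BipGraph n₁ n₂ → ℝ) :
    ∑ G with #G = t, f G * #(extensions d₁ d₂ G) =
      ∑ H ∈ biregular n₁ n₂ d₁ d₂, ∑ G ∈ powersetCard t H, f G := by
  have e : ∀ G, f G * #(extensions d₁ d₂ G) =
      ∑ H ∈ biregular n₁ n₂ d₁ d₂, if G ⊆ H then f G else 0 := by
    intro G
    rw [← sum_filter, sum_const, nsmul_eq_mul, mul_comm]
    rfl
  simp only [e]
  rw [sum_comm]
  refine sum_congr rfl fun H _ => ?_
  rw [← sum_filter, filter_filter]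
  refine sum_congr ?_ fun _ _ => rfl
  ext G
  simp [mem_powersetCard, and_comm]

open Classical in
lemma sum_prefixLaw_le {t : ℕ} (ht : t ≤ n₁ * d₁) (hR : (biregular n₁ n₂ d₁ d₂).Nonempty)
    (P : BipGraph n₁ n₂ → Prop) {β : ℝ}
    (hP : ∀ H ∈ biregular n₁ n₂ d₁ d₂,
      (#{G ∈ powersetCard t H | P G} : ℝ) ≤ (n₁ * d₁).choose t * β) :
    ∑ G with P G, prefixLaw n₁ n₂ d₁ d₂ t G ≤ β := by
  have hC : (0 : ℝ) < (n₁ * d₁).choose t := by exact_mod_cast Nat.choose_pos ht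
  have hr : (0 : ℝ) < #(biregular n₁ n₂ d₁ d₂) := by exact_mod_cast hR.card_pos
  have e : ∑ G with P G, prefixLaw n₁ n₂ d₁ d₂ t G =
      (∑ G with #G = t, (if P G then 1 else 0) * (#(extensions d₁ d₂ G) : ℝ)) /
        (#(biregular n₁ n₂ d₁ d₂) * (n₁ * d₁).choose t) := by
    rw [sum_div, sum_filter, sum_filter]
    refine sum_congr rfl fun G _ => ?_
    unfold prefixLaw
    split_ifs <;> simp
  rw [e, sum_card_eq_sum_extensions, div_le_iff₀ (by positivity)]
  calc ∑ H ∈ biregular n₁ n₂ d₁ d₂, ∑ G ∈ powersetCard t H, (if P G then (1 : ℝ) else 0)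
      ≤ ∑ H ∈ biregular n₁ n₂ d₁ d₂, (n₁ * d₁).choose t * β := by
        refine sum_le_sum fun H hH => ?_
        rw [sum_boole]
        exact hP H hH
    _ = β * (#(biregular n₁ n₂ d₁ d₂) * (n₁ * d₁).choose t) := by
        rw [sum_const, nsmul_eq_mul]
        ring

/-- Completing a random part of a random biregular graph at random gives a uniformly random
biregular graph. -/
lemma mix_prefixLaw_unif {t : ℕ} (ht : t ≤ n₁ * d₁) :
    mix (prefixLaw n₁ n₂ d₁ d₂ t) (fun G => unif (extensions d₁ d₂ G)) =
      unif (biregular n₁ n₂ d₁ d₂) := by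
  have hC : (0 : ℝ) < (n₁ * d₁).choose t := by exact_mod_cast Nat.choose_pos ht
  ext H
  by_cases hH : H ∈ biregular n₁ n₂ d₁ d₂
  · have each : ∀ G, prefixLaw n₁ n₂ d₁ d₂ t G * unif (extensions d₁ d₂ G) H =
        if G ∈ powersetCard t H then
          1 / (#(biregular n₁ n₂ d₁ d₂) * ((n₁ * d₁).choose t : ℝ)) else 0 := by
      intro G
      unfold prefixLaw unif
      by_cases h1 : G ⊆ H
      · have hmem : H ∈ extensions d₁ d₂ G := mem_filter.2 ⟨hH, h1⟩
        have : (#(extensions d₁ d₂ G) : ℝ) ≠ 0 := by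
          exact_mod_cast (card_pos.2 ⟨H, hmem⟩).ne'
        by_cases h2 : #G = t
        · rw [if_pos h2, if_pos hmem, if_pos (mem_powersetCard.2 ⟨h1, h2⟩)]
          field_simp
        · rw [if_neg h2, if_neg fun h => h2 (mem_powersetCard.1 h).2, zero_mul]
      · rw [if_neg (c := H ∈ extensions d₁ d₂ G) fun h => h1 (mem_filter.1 h).2,
          if_neg (c := G ∈ _) fun h => h1 (mem_powersetCard.1 h).1, mul_zero]
    have hcard : #H = n₁ * d₁ :=
      (mem_extensions.1 (mem_filter.2 ⟨hH, empty_subset H⟩)).1.card_eq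
    unfold mix
    simp only [each]
    rw [sum_ite_mem, univ_inter, sum_const, card_powersetCard, hcard, nsmul_eq_mul, unif,
      if_pos hH]
    field_simp
  · unfold mix unif
    rw [if_neg hH]
    refine sum_eq_zero fun G _ => ?_
    dsimp only
    rw [if_neg fun h => hH (extensions_subset_biregular G h), mul_zero]

end BipGraph

/-! ### Random edges added independently of the past -/

namespace BipGraph

open FiniteLaw

variable {n₁ n₂ d₁ d₂ : ℕ}

/-- No edge with probability `ε`, and otherwise a uniformly random edge. -/
noncomputable def edgeOrNone (n₁ n₂ : ℕ) (ε : ℝ) : Option (Fin n₁ × Fin n₂) → ℝ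
  | none => ε
  | some _ => (1 - ε) / ((n₁ * n₂ : ℕ) : ℝ)

/-- The graph `S` together with an optional edge. -/
def addEdge (S : BipGraph n₁ n₂) (o : Option (Fin n₁ × Fin n₂)) : BipGraph n₁ n₂ :=
  o.elim S (insert · S)

/-- The law of the graph formed by `t` independent edges with law `edgeOrNone`. -/
noncomputable def sprinkled (n₁ n₂ : ℕ) (ε : ℝ) : ℕ → BipGraph n₁ n₂ → ℝ
  | 0 => Pi.single ∅ 1
  | t + 1 => mix (sprinkled n₁ n₂ ε t)
      (fun S => mix (edgeOrNone n₁ n₂ ε) fun o => Pi.single (addEdge S o) 1)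

lemma edgeOrNone_mem (hn₁ : 0 < n₁) (hn₂ : 0 < n₂) {ε : ℝ} (h0 : 0 ≤ ε) (h1 : ε ≤ 1) :
    edgeOrNone n₁ n₂ ε ∈ stdSimplex ℝ (Option (Fin n₁ × Fin n₂)) := by
  have h1' : 0 ≤ 1 - ε := by linarith
  constructor
  · rintro (_ | e)
    · exact h0
    · exact div_nonneg h1' (Nat.cast_nonneg _)
  · rw [Fintype.sum_option]
    simp only [edgeOrNone, sum_const, card_univ, Fintype.card_prod, Fintype.card_fin, nsmul_eq_mul]
    have : ((n₁ * n₂ : ℕ) : ℝ) ≠ 0 := by positivity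
    field_simp
    ring

lemma sprinkled_step_mem (hn₁ : 0 < n₁) (hn₂ : 0 < n₂) {ε : ℝ} (h0 : 0 ≤ ε) (h1 : ε ≤ 1)
    (S : BipGraph n₁ n₂) :
    mix (edgeOrNone n₁ n₂ ε) (fun o => Pi.single (addEdge S o) 1) ∈
      stdSimplex ℝ (BipGraph n₁ n₂) :=
  mix_mem (edgeOrNone_mem hn₁ hn₂ h0 h1) fun _ _ => single_mem _

lemma sprinkled_mem (hn₁ : 0 < n₁) (hn₂ : 0 < n₂) {ε : ℝ} (h0 : 0 ≤ ε) (h1 : ε ≤ 1) (t : ℕ) :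
    sprinkled n₁ n₂ ε t ∈ stdSimplex ℝ (BipGraph n₁ n₂) := by
  induction t with
  | zero => exact single_mem _
  | succ t ih => exact mix_mem ih fun S _ => sprinkled_step_mem hn₁ hn₂ h0 h1 S

lemma card_addEdge_le (S : BipGraph n₁ n₂) (o : Option (Fin n₁ × Fin n₂)) :
    #(addEdge S o) ≤ #S + 1 := by
  cases o with
  | none => exact Nat.le_succ _
  | some e => exact card_insert_le e S

lemma card_le_of_sprinkled_ne_zero {ε : ℝ} {t : ℕ} {S : BipGraph n₁ n₂}
    (h : sprinkled n₁ n₂ ε t S ≠ 0) : #S ≤ t := by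
  induction t generalizing S with
  | zero =>
    by_contra hS
    exact hS (by rw [eq_of_single_ne_zero h]; rfl)
  | succ t ih =>
    obtain ⟨S', h1, h2⟩ := mix_ne_zero h
    obtain ⟨o, -, h3⟩ := mix_ne_zero h2
    rw [eq_of_single_ne_zero h3]
    exact (card_addEdge_le S' o).trans (Nat.succ_le_succ (ih h1))

/-- All graphs with the same number of edges are equally likely. -/
lemma sprinkled_eq_card (ε : ℝ) (t : ℕ) :
    ∃ φ : ℕ → ℝ, ∀ S : BipGraph n₁ n₂, sprinkled n₁ n₂ ε t S = φ #S := by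
  induction t with
  | zero =>
    refine ⟨fun j => if j = 0 then 1 else 0, fun S => ?_⟩
    simp [sprinkled, Pi.single_apply]
  | succ t ih =>
    obtain ⟨φ, hφ⟩ := ih
    refine ⟨fun j => φ j * ε + j * ((φ j + φ (j - 1)) * ((1 - ε) / ((n₁ * n₂ : ℕ) : ℝ))),
      fun K => ?_⟩
    have inner : ∀ e, ∑ S : BipGraph n₁ n₂, φ #S * ((1 - ε) / ((n₁ * n₂ : ℕ) : ℝ) *
        (Pi.single (insert e S) 1 : BipGraph n₁ n₂ → ℝ) K) =
        if e ∈ K then (φ #K + φ (#K - 1)) * ((1 - ε) / ((n₁ * n₂ : ℕ) : ℝ)) else 0 := by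
      intro e
      split_ifs with he
      · have : ({S | K = insert e S} : Finset (BipGraph n₁ n₂)) = {K, K.erase e} := by
          ext S
          simp only [mem_filter, mem_univ, true_and, mem_insert, mem_singleton]
          constructor
          · intro h
            by_cases heS : e ∈ S
            · left
              rw [h, insert_eq_of_mem heS]
            · right
              rw [h, erase_insert heS]
          · rintro (rfl | rfl)
            · rw [insert_eq_of_mem he]
            · rw [insert_erase he]
        simp only [Pi.single_apply, mul_ite, mul_one, mul_zero]
        rw [← sum_filter, this, sum_pair, card_erase_of_mem he]
        · ring
        · intro h
          exact notMem_erase e K (h ▸ he)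
      · refine sum_eq_zero fun S _ => ?_
        have : K ≠ insert e S := by
          rintro rfl
          simp at he
        simp [this]
    have none' : ∑ S : BipGraph n₁ n₂, φ #S * (ε * (Pi.single S 1 : BipGraph n₁ n₂ → ℝ) K) =
        φ #K * ε := by
      simp [Pi.single_apply]
    simp only [sprinkled, mix, Fintype.sum_option, edgeOrNone, addEdge, Option.elim, hφ, mul_add,
      sum_add_distrib, mul_sum]
    rw [none', sum_comm]
    simp only [inner, sum_ite_mem, univ_inter, sum_const, nsmul_eq_mul]

/-- If few of the edges are wasted because they are absent or repeated, then small graphs are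
exponentially unlikely. -/
lemma sum_sprinkled_mul_pow_le (hn₁ : 0 < n₁) (hn₂ : 0 < n₂) {ε q : ℝ} (h0 : 0 ≤ ε) (h1 : ε ≤ 1)
    {t : ℕ} (ht : (t : ℝ) ≤ q * ((n₁ * n₂ : ℕ) : ℝ)) :
    ∑ S, sprinkled n₁ n₂ ε t S * (1 / 2 : ℝ) ^ #S ≤ ((1 + (ε + q)) / 2) ^ t := by
  have hN : (0 : ℝ) < ((n₁ * n₂ : ℕ) : ℝ) := by positivity
  have hq : 0 ≤ q := by
    by_contra hq
    push Not at hq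
    have : (0 : ℝ) ≤ t := Nat.cast_nonneg t
    nlinarith
  induction t with
  | zero => simp [sprinkled, Pi.single_apply]
  | succ t ih =>
    push_cast at ht
    have ih := ih (by push_cast; linarith)
    have each : ∀ S, sprinkled n₁ n₂ ε t S * ∑ K, mix (edgeOrNone n₁ n₂ ε)
        (fun o => Pi.single (addEdge S o) 1) K * (1 / 2 : ℝ) ^ #K ≤
        sprinkled n₁ n₂ ε t S * (1 / 2 : ℝ) ^ #S * ((1 + (ε + q)) / 2) := by
      intro S
      by_cases hS : sprinkled n₁ n₂ ε t S = 0
      · simp [hS]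
      have hcard := card_le_of_sprinkled_ne_zero hS
      rw [mul_assoc]
      refine mul_le_mul_of_nonneg_left ?_ ((sprinkled_mem hn₁ hn₂ h0 h1 t).1 S)
      have e1 : ∀ e : Fin n₁ × Fin n₂, (1 / 2 : ℝ) ^ #(insert e S) =
          (1 / 2 : ℝ) ^ #S * (1 / 2 + if e ∈ S then 1 / 2 else 0) := by
        intro e
        by_cases he : e ∈ S
        · simp [he]
          norm_num
        · simp [he, pow_succ]
      rw [sum_mix_mul, Fintype.sum_option]
      simp only [edgeOrNone, addEdge, Option.elim, Pi.single_apply, ite_mul, one_mul, zero_mul,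
        sum_ite_eq', mem_univ, if_true, e1]
      rw [← mul_sum, ← mul_sum, sum_add_distrib, sum_ite_mem, univ_inter, sum_const, sum_const,
        card_univ, Fintype.card_prod, Fintype.card_fin, Fintype.card_fin, nsmul_eq_mul,
        nsmul_eq_mul]
      have hs : (#S : ℝ) / ((n₁ * n₂ : ℕ) : ℝ) ≤ q := by
        rw [div_le_iff₀ hN]
        have : (#S : ℝ) ≤ t := by exact_mod_cast hcard
        push_cast
        linarith
      have hpos : (0 : ℝ) ≤ (1 / 2) ^ #S := by positivity
      have hb : ε + (1 - ε) * (1 / 2 + (#S : ℝ) / ((n₁ * n₂ : ℕ) : ℝ) * (1 / 2)) ≤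
          (1 + (ε + q)) / 2 := by
        have h2 : (1 - ε) * ((#S : ℝ) / ((n₁ * n₂ : ℕ) : ℝ)) ≤ 1 * q :=
          mul_le_mul (by linarith) hs (by positivity) (by norm_num)
        linarith
      refine le_trans (le_of_eq ?_) (mul_le_mul_of_nonneg_left hb hpos)
      field_simp
    have hmix : sprinkled n₁ n₂ ε (t + 1) = mix (sprinkled n₁ n₂ ε t)
      (fun S => mix (edgeOrNone n₁ n₂ ε) fun o => Pi.single (addEdge S o) 1) := rfl
    rw [hmix, sum_mix_mul, pow_succ]
    refine (sum_le_sum fun S _ => each S).trans ?_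
    rw [← sum_mul]
    have : 0 ≤ (1 + (ε + q)) / 2 := by linarith
    gcongr

lemma sum_sprinkled_card_lt_le (hn₁ : 0 < n₁) (hn₂ : 0 < n₂) {ε q : ℝ} (h0 : 0 ≤ ε) (h1 : ε ≤ 1)
    {t : ℕ} (ht : (t : ℝ) ≤ q * ((n₁ * n₂ : ℕ) : ℝ)) (k : ℕ) :
    ∑ S with #S < k, sprinkled n₁ n₂ ε t S ≤ 2 ^ k * ((1 + (ε + q)) / 2) ^ t := by
  have hpos := (sprinkled_mem hn₁ hn₂ h0 h1 t).1
  calc ∑ S with #S < k, sprinkled n₁ n₂ ε t S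
      ≤ ∑ S with #S < k, 2 ^ k * (sprinkled n₁ n₂ ε t S * (1 / 2 : ℝ) ^ #S) := by
        refine sum_le_sum fun S hS => ?_
        have hS' := (mem_filter.1 hS).2
        have : (1 : ℝ) ≤ 2 ^ k * (1 / 2 : ℝ) ^ #S := by
          calc (1 : ℝ) = 2 ^ #S * (1 / 2 : ℝ) ^ #S := by rw [← mul_pow]; norm_num
            _ ≤ 2 ^ k * (1 / 2 : ℝ) ^ #S := by gcongr; norm_num
        nlinarith [hpos S]
    _ ≤ ∑ S, 2 ^ k * (sprinkled n₁ n₂ ε t S * (1 / 2 : ℝ) ^ #S) :=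
        sum_le_sum_of_subset_of_nonneg (filter_subset _ _) fun S _ _ => by
          have := hpos S
          positivity
    _ ≤ 2 ^ k * ((1 + (ε + q)) / 2) ^ t := by
        rw [← mul_sum]
        gcongr
        exact sum_sprinkled_mul_pow_le hn₁ hn₂ h0 h1 ht

/-! ### Thinning to a uniform graph with a given number of edges -/

/-- A uniform subgraph of `S` with `k` edges if there is one, and otherwise a uniform graph with `k`
edges. -/
noncomputable def thin (k : ℕ) (S : BipGraph n₁ n₂) : BipGraph n₁ n₂ → ℝ :=
  if k ≤ #S then unif (powersetCard k S) else unif (withEdges n₁ n₂ k)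

lemma withEdges_eq (k : ℕ) : withEdges n₁ n₂ k = powersetCard k univ := by
  ext G
  simp [withEdges, mem_powersetCard]

lemma withEdges_nonempty {k : ℕ} (hk : k ≤ n₁ * n₂) : (withEdges n₁ n₂ k).Nonempty := by
  rw [withEdges_eq, powersetCard_nonempty]
  simpa using hk

lemma thin_mem {k : ℕ} (hk : k ≤ n₁ * n₂) (S : BipGraph n₁ n₂) :
    thin k S ∈ stdSimplex ℝ (BipGraph n₁ n₂) := by
  unfold thin
  split_ifs with h
  · exact unif_mem (powersetCard_nonempty.2 h)
  · exact unif_mem (withEdges_nonempty hk)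

lemma sum_superset_eq {α : Type*} [Fintype α] [DecidableEq α] (T : Finset α) (F : ℕ → ℝ) :
    ∑ S with T ⊆ S, F #S =
      ∑ i ∈ range (Fintype.card α - #T + 1), (Fintype.card α - #T).choose i • F (#T + i) := by
  rw [← card_compl, ← sum_powerset_apply_card (fun i => F (#T + i)) (x := Tᶜ)]
  refine sum_nbij' (· \ T) (T ∪ ·) ?_ ?_ ?_ ?_ ?_
  · intro S _
    rw [mem_powerset, compl_eq_univ_sdiff]
    exact sdiff_subset_sdiff (subset_univ _) Subset.rfl
  · intro V _
    simp
  · intro S hS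
    exact union_sdiff_of_subset (mem_filter.1 hS).2
  · intro V hV
    have : Disjoint V T := by
      rw [← le_compl_iff_disjoint_right]
      exact mem_powerset.1 hV
    rw [union_sdiff_left, sdiff_eq_self_of_disjoint this]
  · intro S hS
    rw [← card_sdiff_add_card_eq_card (mem_filter.1 hS).2, add_comm]

lemma mix_thin {μ : BipGraph n₁ n₂ → ℝ} (hμ : μ ∈ stdSimplex ℝ (BipGraph n₁ n₂)) {φ : ℕ → ℝ}
    (hφ : ∀ S, μ S = φ #S) {k : ℕ} (hk : k ≤ n₁ * n₂) :
    mix μ (thin k) = unif (withEdges n₁ n₂ k) := by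
  have hsum := (mix_mem hμ fun S _ => thin_mem hk S).2
  have off : ∀ T, T ∉ withEdges n₁ n₂ k → mix μ (thin k) T = 0 := by
    intro T hT
    refine sum_eq_zero fun S _ => ?_
    have : thin k S T = 0 := by
      unfold thin
      split_ifs
      · exact if_neg fun h => hT (by rw [withEdges_eq]; exact powersetCard_mono (subset_univ _) h)
      · exact if_neg hT
    rw [this, mul_zero]
  have const : ∃ c, ∀ T ∈ withEdges n₁ n₂ k, mix μ (thin k) T = c := by
    refine ⟨∑ i ∈ range (n₁ * n₂ - k + 1), (n₁ * n₂ - k).choose i •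
        (φ (k + i) * (((k + i).choose k : ℕ) : ℝ)⁻¹) +
      ∑ S : BipGraph n₁ n₂ with ¬ k ≤ #S, φ #S * (#(withEdges n₁ n₂ k) : ℝ)⁻¹, fun T hT => ?_⟩
    have hTk : #T = k := by simpa [withEdges] using hT
    have h := sum_superset_eq T (fun j => φ j * ((j.choose k : ℕ) : ℝ)⁻¹)
    simp only [Fintype.card_prod, Fintype.card_fin, hTk] at h
    rw [← h, sum_filter, sum_filter, ← sum_add_distrib]
    refine sum_congr rfl fun S _ => ?_
    unfold thin
    by_cases hS : k ≤ #S
    · rw [if_pos hS, if_neg (not_not.2 hS), add_zero, hφ, unif]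
      by_cases hTS : T ⊆ S
      · rw [if_pos (mem_powersetCard.2 ⟨hTS, hTk⟩), if_pos hTS, card_powersetCard]
      · rw [if_neg fun h => hTS (mem_powersetCard.1 h).1, if_neg hTS, mul_zero]
    · have hTS : ¬ T ⊆ S := fun h => hS (hTk ▸ card_le_card h)
      rw [if_neg hS, if_pos hS, if_neg hTS, zero_add, hφ, unif, if_pos hT]
  obtain ⟨c, hc⟩ := const
  have hcard : (#(withEdges n₁ n₂ k) : ℝ) ≠ 0 := by
    exact_mod_cast (withEdges_nonempty hk).card_pos.ne'
  have hc' : (#(withEdges n₁ n₂ k) : ℝ) * c = 1 := by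
    rw [← hsum, ← sum_subset (subset_univ (withEdges n₁ n₂ k)) fun T _ hT => off T hT,
      sum_congr rfl hc, sum_const, nsmul_eq_mul]
  ext T
  unfold unif
  split_ifs with hT
  · rw [hc T hT]
    field_simp
    linarith
  · exact off T hT

lemma couples_thin {S R : BipGraph n₁ n₂} {k : ℕ} (hk : k ≤ #S) (hSR : S ⊆ R) :
    Couples (fun G H : BipGraph n₁ n₂ => G ⊆ H) (thin k S) (Pi.single R 1) 0 := by
  have hk' : k ≤ n₁ * n₂ := hk.trans ((card_le_univ S).trans_eq (by simp))
  refine couples_of_support (thin_mem hk' S) (single_mem R) fun T K hT hK => ?_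
  rw [thin, if_pos hk] at hT
  rw [eq_of_single_ne_zero hK]
  exact (mem_powersetCard.1 (mem_of_unif_ne_zero hT)).1.trans hSR

/-! ### Coupling the two processes -/

/-- One step of the two processes: if `G` is such that every new edge is likely enough, then either
the same edge is added on both sides, or the edge on the left already belongs to `G`, or no edge is
added on the left. -/
lemma couples_step {ε : ℝ} (h0 : 0 ≤ ε) (h1 : ε ≤ 1) (hn₁ : 0 < n₁) (hn₂ : 0 < n₂)
    {S G : BipGraph n₁ n₂} (hSG : S ⊆ G)
    (hG : nextEdge d₁ d₂ G ∈ stdSimplex ℝ (Fin n₁ × Fin n₂))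
    (hnext : ∀ e ∉ G, (1 - ε) / ((n₁ * n₂ : ℕ) : ℝ) ≤ nextEdge d₁ d₂ G e) :
    Couples (fun S G : BipGraph n₁ n₂ => S ⊆ G)
      (mix (edgeOrNone n₁ n₂ ε) fun o => Pi.single (addEdge S o) 1)
      (mix (nextEdge d₁ d₂ G) fun e => Pi.single (insert e G) 1) 0 := by
  have hε : 0 ≤ (1 - ε) / ((n₁ * n₂ : ℕ) : ℝ) := div_nonneg (by linarith) (Nat.cast_nonneg _)
  have hO := edgeOrNone_mem hn₁ hn₂ h0 h1
  have base : Couples (fun o e => addEdge S o ⊆ insert e G) (edgeOrNone n₁ n₂ ε)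
      (nextEdge d₁ d₂ G) 0 := by
    -- Draw the same edge `e ∉ G` on both sides with probability `(1 - ε) / (n₁ n₂)`. All other
    -- outcomes on the left are harmless.
    refine couples_of_partial hO hG
      (fun x => if x.1 = some x.2 ∧ x.2 ∉ G then (1 - ε) / ((n₁ * n₂ : ℕ) : ℝ) else 0)
      (fun x => by split_ifs; exacts [hε, le_rfl]) ?_ ?_ ?_ ?_
    · rintro (_ | f)
      · simpa using hO.1 none
      · by_cases hf : f ∈ G
        · refine le_trans (le_of_eq (sum_eq_zero fun e _ => if_neg ?_)) (hO.1 _)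
          rintro ⟨h, h'⟩
          exact h' (Option.some.inj h ▸ hf)
        · rw [sum_eq_single f]
          · simp [hf, edgeOrNone]
          · intro e _ hne
            exact if_neg fun h => hne (Option.some.inj h.1).symm
          · simp
    · intro e
      by_cases he : e ∈ G
      · simpa [he] using hG.1 e
      · simpa [he] using hnext e he
    · rintro o e h
      have h' : o = some e ∧ e ∉ G := by
        by_contra hne
        exact h (if_neg hne)
      rw [h'.1]
      exact insert_subset_insert e hSG
    · rintro (_ | f) e h -
      · exact hSG.trans (subset_insert _ _)
      · by_cases hf : f ∈ G
        · exact insert_subset (mem_insert_of_mem hf) (hSG.trans (subset_insert _ _))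
        · refine absurd ?_ h
          rw [sum_eq_single f]
          · simp [hf, edgeOrNone]
          · intro e _ hne
            exact if_neg fun h => hne (Option.some.inj h.1).symm
          · simp
  have := base.mix (r' := fun S G : BipGraph n₁ n₂ => S ⊆ G)
    (k := fun o => Pi.single (addEdge S o) 1) (l := fun e => Pi.single (insert e G) 1)
    (fun _ => False) (fun _ => False) hO le_rfl (fun _ _ => single_mem _)
    (fun _ _ => single_mem _) (δA := 0) (δB := 0) (by simp) (by simp)
    (fun o e h _ _ _ _ => couples_of_support (single_mem _) (single_mem _) fun T K hT hK => by
      rwa [eq_of_single_ne_zero hT, eq_of_single_ne_zero hK])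
  simpa using this

/-- Independent random edges, some of them absent, can be coupled with the edges of a random biregular
graph in random order, up to the probability that the latter process is ever unbalanced. -/
lemma couples_process {ε δ β : ℝ} (h0 : 0 ≤ ε) (h1 : ε ≤ 1) (hn₁ : 0 < n₁) (hn₂ : 0 < n₂)
    (hR : (biregular n₁ n₂ d₁ d₂).Nonempty) {t₀ : ℕ} (ht₀ : t₀ ≤ n₁ * d₁)
    (hnext : ∀ G : BipGraph n₁ n₂, #G < t₀ → Balanced d₁ d₂ δ G → ∀ e ∉ G,
      (1 - ε) / ((n₁ * n₂ : ℕ) : ℝ) * ((((n₁ * d₁ : ℕ) : ℝ) - #G) * #(extensions d₁ d₂ G)) ≤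
        #(extensions d₁ d₂ (insert e G)))
    (hbal : ∀ t < t₀, ∀ H ∈ biregular n₁ n₂ d₁ d₂,
      (#(open Classical in {G ∈ powersetCard t H | ¬ Balanced d₁ d₂ δ G}) : ℝ) ≤
        (n₁ * d₁).choose t * β) :
    ∀ t ≤ t₀, Couples (fun S G : BipGraph n₁ n₂ => S ⊆ G) (sprinkled n₁ n₂ ε t)
      (prefixLaw n₁ n₂ d₁ d₂ t) (t * β) := by
  intro t
  induction t with
  | zero =>
    intro _
    rw [prefixLaw_zero hR]
    rw [Nat.cast_zero, zero_mul]
    refine couples_of_support (single_mem _) (single_mem _) fun S G hS _ => ?_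
    rw [eq_of_single_ne_zero hS]
    exact empty_subset G
  | succ t ih =>
    intro ht
    have htm : t < n₁ * d₁ := by omega
    rw [prefixLaw_succ htm]
    have := (ih (by omega)).mix (r' := fun S G : BipGraph n₁ n₂ => S ⊆ G)
      (k := fun S => mix (edgeOrNone n₁ n₂ ε) fun o => Pi.single (addEdge S o) 1)
      (l := fun G => mix (nextEdge d₁ d₂ G) fun e => Pi.single (insert e G) 1)
      (fun _ => False) (fun G => ¬ Balanced d₁ d₂ δ G) (sprinkled_mem hn₁ hn₂ h0 h1 t) le_rfl
      (fun S _ => sprinkled_step_mem hn₁ hn₂ h0 h1 S) (prefixLaw_step_mem htm) (δA := 0)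
      (δB := β) (by simp) (sum_prefixLaw_le htm.le hR _ fun H hH => by
        convert hbal t (by omega) H hH) ?_
    · refine this.mono (fun _ _ h => h) (le_of_eq ?_)
      push_cast
      ring
    · intro S G hSG _ hG _ hνG
      obtain ⟨hc, hext⟩ := prefixLaw_ne_zero hνG
      refine couples_step h0 h1 hn₁ hn₂ hSG (nextEdge_mem hext (hc ▸ htm)) fun e he => ?_
      have hlt : (0 : ℝ) < ((n₁ * d₁ : ℕ) : ℝ) - #G := by
        rw [sub_pos, hc]
        exact_mod_cast htm
      have hr : (0 : ℝ) < #(extensions d₁ d₂ G) := by exact_mod_cast hext.card_pos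
      rw [nextEdge, if_neg he, le_div_iff₀ (by positivity)]
      exact hnext G (by omega) (not_not.1 hG) e he

/-- The uniform graph with `k` edges is coupled to a random biregular graph, given that the process of
independent edges is. -/
lemma couples_withEdges {ε η β : ℝ} (h0 : 0 ≤ ε) (h1 : ε ≤ 1) (hn₁ : 0 < n₁) (hn₂ : 0 < n₂)
    {t₀ k : ℕ} (ht₀ : t₀ ≤ n₁ * d₁) (hk : k ≤ n₁ * n₂)
    (h : Couples (fun S G : BipGraph n₁ n₂ => S ⊆ G) (sprinkled n₁ n₂ ε t₀)
      (prefixLaw n₁ n₂ d₁ d₂ t₀) β)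
    (hη : ∑ S with #S < k, sprinkled n₁ n₂ ε t₀ S ≤ η) :
    Couples (fun S G : BipGraph n₁ n₂ => S ⊆ G) (unif (withEdges n₁ n₂ k))
      (unif (biregular n₁ n₂ d₁ d₂)) (β + η) := by
  have hμ := sprinkled_mem hn₁ hn₂ h0 h1 t₀
  obtain ⟨φ, hφ⟩ := sprinkled_eq_card (n₁ := n₁) (n₂ := n₂) ε t₀
  have hext : ∀ G : BipGraph n₁ n₂, prefixLaw n₁ n₂ d₁ d₂ t₀ G ≠ 0 →
      unif (extensions d₁ d₂ G) ∈ stdSimplex ℝ (BipGraph n₁ n₂) := fun G hG =>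
    unif_mem (prefixLaw_ne_zero hG).2
  have c1 := h.mix (r' := fun S G : BipGraph n₁ n₂ => S ⊆ G)
    (k := fun S => Pi.single S 1) (l := fun G => unif (extensions d₁ d₂ G))
    (fun _ => False) (fun _ => False) hμ le_rfl (fun _ _ => single_mem _) hext (δA := 0)
    (δB := 0) (by simp) (by simp) (by
      intro S G hSG _ _ _ hG
      refine couples_of_support (single_mem S) (hext G hG) fun T K hT hK => ?_
      rw [eq_of_single_ne_zero hT]
      exact hSG.trans (mem_extensions.1 (mem_of_unif_ne_zero hK)).2)
  rw [mix_single, mix_prefixLaw_unif ht₀] at c1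
  have c2 := c1.mix (r' := fun S G : BipGraph n₁ n₂ => S ⊆ G)
    (k := thin k) (l := fun G => Pi.single G 1)
    (fun S => #S < k) (fun _ => False) hμ le_rfl (fun S _ => thin_mem hk S)
    (fun _ _ => single_mem _) (δA := η) (δB := 0) (by convert hη) (by simp)
    (fun S R hSR hS _ _ _ => couples_thin (not_lt.1 hS) hSR)
  rw [mix_single, mix_thin hμ hφ hk] at c2
  exact c2.mono (fun _ _ h => h) (by linarith)

end BipGraph

/-! ### Existence of biregular graphs -/

namespace BipGraph

open FiniteLaw

variable {n₁ n₂ d₁ d₂ : ℕ}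

/-- Number the `m` edges cyclically on the right side, and in blocks of `d₁` on the left side. As
`d₁ ≤ n₂`, no edge occurs twice. -/
lemma biregular_nonempty (hm : n₁ * d₁ = n₂ * d₂) (hd : d₁ ≤ n₂) :
    (biregular n₁ n₂ d₁ d₂).Nonempty := by
  have hm' : n₁ * d₁ = d₂ * n₂ := by rw [hm, mul_comm]
  set f : Fin (n₁ * d₁) → Fin n₁ × Fin n₂ := fun i => (i.divNat, (Fin.cast hm' i).modNat) with hf
  have hinj : Function.Injective f := by
    intro i j hij
    have h1 : (i : ℕ) / d₁ = j / d₁ := congrArg (fun x => (x.1 : ℕ)) hij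
    have h2 : (i : ℕ) % n₂ = j % n₂ := congrArg (fun x => (x.2 : ℕ)) hij
    have hd₁ : 0 < d₁ := by
      rcases Nat.eq_zero_or_pos d₁ with h | h
      · have := i.2
        simp [h] at this
      · exact h
    have key : ∀ a b : ℕ, a ≤ b → a / d₁ = b / d₁ → a % n₂ = b % n₂ → a = b := by
      intro a b hab h1 h2
      have hlt : b - a < n₂ := by
        have := Nat.div_add_mod a d₁
        have := Nat.div_add_mod b d₁
        have := Nat.mod_lt a hd₁
        have := Nat.mod_lt b hd₁
        rw [h1] at *
        omega
      have := (Nat.modEq_iff_dvd' hab).1 h2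
      have := Nat.eq_zero_of_dvd_of_lt this hlt
      omega
    refine Fin.ext ?_
    rcases le_total (i : ℕ) j with h | h
    · exact key _ _ h h1 h2
    · exact (key _ _ h h1.symm h2.symm).symm
  refine ⟨univ.image f, mem_biregular.2 ⟨fun u => ?_, fun v => ?_⟩⟩
  · rw [degLeft, filter_image, card_image_of_injective _ hinj]
    refine (card_nbij' (t := (univ : Finset (Fin d₁))) Fin.modNat
      (fun j => finProdFinEquiv (u, j)) ?_ ?_ ?_ ?_).trans (by simp)
    · intro i _
      simp
    · intro j _
      have := congrArg Prod.fst (finProdFinEquiv.symm_apply_apply (u, j))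
      exact mem_coe.2 (mem_filter.2 ⟨mem_univ _, this⟩)
    · intro i hi
      have hi' : i.divNat = u := by simpa [hf] using hi
      rw [← hi']
      exact finProdFinEquiv.apply_symm_apply i
    · intro j _
      exact congrArg Prod.snd (finProdFinEquiv.symm_apply_apply (u, j))
  · rw [degRight, filter_image, card_image_of_injective _ hinj]
    refine (card_nbij' (t := (univ : Finset (Fin d₂))) (fun i => (Fin.cast hm' i).divNat)
      (fun j => Fin.cast hm'.symm (finProdFinEquiv (j, v))) ?_ ?_ ?_ ?_).trans (by simp)
    · intro i _
      simp
    · intro j _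
      have := congrArg Prod.snd (finProdFinEquiv.symm_apply_apply (j, v))
      exact mem_coe.2 (mem_filter.2 ⟨mem_univ _, this⟩)
    · intro i hi
      have hi' : (Fin.cast hm' i).modNat = v := by simpa [hf] using hi
      rw [← hi']
      have := finProdFinEquiv.apply_symm_apply (Fin.cast hm' i)
      exact (congrArg (Fin.cast hm'.symm) this).trans (by simp)
    · intro j _
      have := congrArg Prod.fst (finProdFinEquiv.symm_apply_apply (j, v))
      exact this

/-! ### The Erdős–Rényi distribution -/

/-- The Erdős–Rényi distribution as a real-valued function. -/
noncomputable def erWeight (n₁ n₂ : ℕ) (p : ℝ) (G : BipGraph n₁ n₂) : ℝ :=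
  p ^ #G * (1 - p) ^ (n₁ * n₂ - #G)

lemma toReal_erdosRenyi {p : ℝ} (hp : p ∈ Set.Icc (0 : ℝ) 1) :
    (fun G => (erdosRenyi n₁ n₂ p hp G).toReal) = erWeight n₁ n₂ p := by
  ext G
  have h0 : 0 ≤ p := hp.1
  have h1 : 0 ≤ 1 - p := by linarith [hp.2]
  rw [erdosRenyi, PMF.ofFintype_apply, ENNReal.toReal_ofReal (by positivity)]
  rfl

lemma sum_erWeight_mul_pow (p z : ℝ) :
    ∑ G, erWeight n₁ n₂ p G * z ^ #G = (z * p + (1 - p)) ^ (n₁ * n₂) := by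
  have h := Fintype.sum_pow_mul_eq_add_pow (Fin n₁ × Fin n₂) (z * p) (1 - p)
  simp only [Fintype.card_prod, Fintype.card_fin] at h
  rw [← h]
  refine sum_congr rfl fun G _ => ?_
  rw [erWeight, mul_pow]
  ring

lemma erWeight_mem {p : ℝ} (hp : p ∈ Set.Icc (0 : ℝ) 1) :
    erWeight n₁ n₂ p ∈ stdSimplex ℝ (BipGraph n₁ n₂) := by
  have h0 : 0 ≤ p := hp.1
  have h1 : 0 ≤ 1 - p := by linarith [hp.2]
  refine ⟨fun G => by unfold erWeight; positivity, ?_⟩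
  have := sum_erWeight_mul_pow (n₁ := n₁) (n₂ := n₂) p 1
  simpa using this

lemma mix_erWeight (p : ℝ) :
    mix (erWeight n₁ n₂ p) (fun H => unif (withEdges n₁ n₂ #H)) = erWeight n₁ n₂ p := by
  ext G
  have each : ∀ H, erWeight n₁ n₂ p H * unif (withEdges n₁ n₂ #H) G =
      if H ∈ withEdges n₁ n₂ #G then erWeight n₁ n₂ p G * (#(withEdges n₁ n₂ #G) : ℝ)⁻¹
        else 0 := by
    intro H
    have hmem : ∀ {K L : BipGraph n₁ n₂}, K ∈ withEdges n₁ n₂ #L ↔ #K = #L := by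
      simp [withEdges]
    unfold unif erWeight
    by_cases h : #H = #G
    · rw [if_pos (hmem.2 h.symm), if_pos (hmem.2 h), h]
    · rw [if_neg fun h' => h (hmem.1 h').symm, if_neg fun h' => h (hmem.1 h'), mul_zero]
  have hG : (#(withEdges n₁ n₂ #G) : ℝ) ≠ 0 := by
    have : G ∈ withEdges n₁ n₂ #G := by simp [withEdges]
    exact_mod_cast (card_pos.2 ⟨G, this⟩).ne'
  unfold mix
  simp only [each]
  rw [sum_ite_mem, univ_inter, sum_const, nsmul_eq_mul]
  field_simp

/-- Chernoff bound for the number of edges. -/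
lemma sum_erWeight_card_gt_le {p : ℝ} (hp : p ∈ Set.Icc (0 : ℝ) 1) {l a : ℝ} (h0 : 0 ≤ l)
    (h1 : l ≤ 1) {k : ℕ} (hk : a ≤ k + 1) :
    ∑ G with k < #G, erWeight n₁ n₂ p G ≤
      Real.exp (-(l * a) + (l + l ^ 2) * (p * ((n₁ * n₂ : ℕ) : ℝ))) := by
  have hpos := (erWeight_mem (n₁ := n₁) (n₂ := n₂) hp).1
  calc ∑ G with k < #G, erWeight n₁ n₂ p G
      ≤ ∑ G with k < #G, Real.exp (-(l * a)) * (erWeight n₁ n₂ p G * Real.exp l ^ #G) := by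
        refine sum_le_sum fun G hG => ?_
        have hG' : (k : ℝ) + 1 ≤ #G := by exact_mod_cast (mem_filter.1 hG).2
        have : 1 ≤ Real.exp (-(l * a)) * Real.exp l ^ #G := by
          rw [← Real.exp_nat_mul, ← Real.exp_add]
          exact Real.one_le_exp (by nlinarith)
        nlinarith [hpos G]
    _ ≤ ∑ G, Real.exp (-(l * a)) * (erWeight n₁ n₂ p G * Real.exp l ^ #G) :=
        sum_le_sum_of_subset_of_nonneg (filter_subset _ _) fun G _ _ => by
          have := hpos G
          positivity
    _ = Real.exp (-(l * a)) * (Real.exp l * p + (1 - p)) ^ (n₁ * n₂) := by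
        rw [← mul_sum, sum_erWeight_mul_pow]
    _ ≤ Real.exp (-(l * a)) * Real.exp ((l + l ^ 2) * p) ^ (n₁ * n₂) := by
        have hp0 := hp.1
        have hp1 := hp.2
        have e1 := Real.exp_pos l
        have e2 : Real.exp l - 1 - l ≤ l ^ 2 :=
          (abs_le.1 (Real.abs_exp_sub_one_sub_id_le (by rwa [abs_of_nonneg h0]))).2
        have e3 := Real.add_one_le_exp ((l + l ^ 2) * p)
        have e4 : (Real.exp l - 1) * p ≤ (l + l ^ 2) * p := by
          gcongr
          linarith
        have e5 : 0 ≤ Real.exp l * p + (1 - p) := add_nonneg (by positivity) (by linarith)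
        gcongr
        linarith
    _ = Real.exp (-(l * a) + (l + l ^ 2) * (p * ((n₁ * n₂ : ℕ) : ℝ))) := by
        rw [← Real.exp_nat_mul, ← Real.exp_add]
        ring_nf

lemma couples_erWeight {p η β : ℝ} (hp : p ∈ Set.Icc (0 : ℝ) 1)
    (hR : (biregular n₁ n₂ d₁ d₂).Nonempty) {k : ℕ} (hβ0 : 0 ≤ β)
    (hη : ∑ G with k < #G, erWeight n₁ n₂ p G ≤ η)
    (h : ∀ j ≤ k, Couples (fun S G : BipGraph n₁ n₂ => S ⊆ G) (unif (withEdges n₁ n₂ j))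
      (unif (biregular n₁ n₂ d₁ d₂)) β) :
    Couples (fun S G : BipGraph n₁ n₂ => S ⊆ G) (erWeight n₁ n₂ p)
      (unif (biregular n₁ n₂ d₁ d₂)) (η + β) := by
  have hER := erWeight_mem (n₁ := n₁) (n₂ := n₂) hp
  have := (couples_true hER (single_mem ())).mix (r' := fun S G : BipGraph n₁ n₂ => S ⊆ G)
    (k := fun H => unif (withEdges n₁ n₂ #H)) (l := fun _ => unif (biregular n₁ n₂ d₁ d₂))
    (fun H => k < #H) (fun _ => False) hER hβ0
    (fun H _ => unif_mem (withEdges_nonempty ((card_le_univ H).trans_eq (by simp))))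
    (fun _ _ => unif_mem hR) (δA := η) (δB := 0) (by convert hη) (by simp)
    (fun H _ _ hH _ _ _ => h _ (not_lt.1 hH))
  rw [mix_erWeight, single_mix] at this
  exact this.mono (fun _ _ h => h) (by linarith)

/-! ### Choice of the parameters -/

/-- The consequences of the lower bound on `γ` that the argument needs. -/
lemma parameter_bounds {d₁ d₂ m : ℕ} (hd₁ : 0 < d₁) (hd₂ : 0 < d₂) (hm : 0 < m) {γ : ℝ}
    (h0 : 0 < γ) (h1 : γ < 1)
    (h : 64 * ((d₁ : ℝ) * (d₂ : ℝ) / (m : ℝ) +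
      Real.log (m : ℝ) / ((min d₁ d₂ : ℕ) : ℝ)) ^ ((1 : ℝ) / 3) ≤ γ) :
    262144 * ((d₁ : ℝ) * d₂ / m) ≤ γ ^ 3 ∧
      262144 * Real.log m ≤ γ ^ 3 * ((min d₁ d₂ : ℕ) : ℝ) ∧ (262144 : ℝ) ≤ m ∧
      1 ≤ Real.log m ∧ 262144 * Real.log m ≤ γ ^ 2 * m := by
  set p : ℝ := (d₁ : ℝ) * d₂ / m with hp
  set D : ℝ := ((min d₁ d₂ : ℕ) : ℝ) with hD
  set L : ℝ := Real.log m with hL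
  have hm1 : (1 : ℝ) ≤ m := by exact_mod_cast hm
  have hL0 : 0 ≤ L := Real.log_nonneg hm1
  have hD1 : (1 : ℝ) ≤ D := by
    rw [hD]
    exact_mod_cast le_min hd₁ hd₂
  have hp0 : 0 < p := by rw [hp]; positivity
  have hx : 0 ≤ p + L / D := by positivity
  have hγ3 : γ ^ 3 ≤ 1 := pow_le_one₀ h0.le h1.le
  have key : 262144 * (p + L / D) ≤ γ ^ 3 := by
    have h3 : (64 * (p + L / D) ^ ((1 : ℝ) / 3)) ^ 3 ≤ γ ^ 3 := by gcongr
    have h4 : ((p + L / D) ^ ((1 : ℝ) / 3)) ^ 3 = p + L / D := by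
      rw [← Real.rpow_natCast, ← Real.rpow_mul hx]
      norm_num
    rw [mul_pow, h4] at h3
    linarith
  have hLD : 0 ≤ L / D := by positivity
  have k1 : 262144 * p ≤ γ ^ 3 := by linarith
  have k2 : 262144 * L ≤ γ ^ 3 * D := by
    have : 262144 * (L / D) ≤ γ ^ 3 := by linarith
    calc 262144 * L = 262144 * (L / D) * D := by field_simp
      _ ≤ γ ^ 3 * D := by gcongr
  have k3 : (262144 : ℝ) ≤ m := by
    have hdd : (1 : ℝ) ≤ d₁ * d₂ := by exact_mod_cast Nat.mul_pos hd₁ hd₂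
    have : 262144 * (d₁ * d₂) ≤ (1 : ℝ) * m := by
      have : 262144 * p ≤ 1 := k1.trans hγ3
      calc 262144 * ((d₁ : ℝ) * d₂) = 262144 * p * m := by rw [hp]; field_simp
        _ ≤ 1 * m := by gcongr
    linarith
  have k4 : 1 ≤ L := by
    rw [hL, Real.le_log_iff_exp_le (by linarith)]
    have := Real.exp_one_lt_d9
    linarith
  refine ⟨k1, k2, k3, k4, ?_⟩
  -- Since `min d₁ d₂ ^ 2 ≤ d₁ d₂`, the two terms of the bound give `γ ^ 9 m ≥ 262144 ^ 3 (log m)²`.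
  have hDD : D ^ 2 ≤ p * m := by
    have e : p * m = d₁ * d₂ := by rw [hp]; field_simp
    rw [e, pow_two, hD]
    exact_mod_cast Nat.mul_le_mul (min_le_left d₁ d₂) (min_le_right d₁ d₂)
  have a1 : 262144 * D ^ 2 ≤ γ ^ 3 * m := by nlinarith
  have a2 : (262144 * L) ^ 2 ≤ (γ ^ 3 * D) ^ 2 := by gcongr
  have a3 : 262144 * (262144 * L) ^ 2 ≤ γ ^ 9 * m := by
    calc 262144 * (262144 * L) ^ 2 ≤ 262144 * (γ ^ 3 * D) ^ 2 := by gcongr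
      _ = (γ ^ 3) ^ 2 * (262144 * D ^ 2) := by ring
      _ ≤ (γ ^ 3) ^ 2 * (γ ^ 3 * m) := by gcongr
      _ = γ ^ 9 * m := by ring
  have a4 : γ ^ 9 * m ≤ γ ^ 2 * m := by
    have : γ ^ 9 ≤ γ ^ 2 := pow_le_pow_of_le_one h0.le h1.le (by norm_num)
    gcongr
  nlinarith

/-- The process runs for `⌊(1 - γ / 4) m⌋` steps with `ε = γ / 16` and balance parameter `γ / 64`. The
constant `262144 = 64 ^ 3` makes each balance condition fail with probability at most `2 / m ^ 4`. -/
lemma couples_withEdges_biregular {m : ℕ} (hn₁ : 0 < n₁) (hn₂ : 0 < n₂) (hd₁ : 0 < d₁)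
    (hd₂ : 0 < d₂) (hm₁ : m = n₁ * d₁) (hm₂ : m = n₂ * d₂) {γ : ℝ} (h0 : 0 < γ) (h1 : γ < 1)
    (hp : 262144 * ((d₁ : ℝ) * d₂ / m) ≤ γ ^ 3)
    (hD : 262144 * Real.log m ≤ γ ^ 3 * ((min d₁ d₂ : ℕ) : ℝ))
    (hm : (262144 : ℝ) ≤ m) (hL : 1 ≤ Real.log m) (hγm : 262144 * Real.log m ≤ γ ^ 2 * m)
    (hR : (biregular n₁ n₂ d₁ d₂).Nonempty) {k : ℕ} (hk : (k : ℝ) ≤ (1 - γ) * m)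
    (hkN : k ≤ n₁ * n₂) :
    Couples (fun S G : BipGraph n₁ n₂ => S ⊆ G) (unif (withEdges n₁ n₂ k))
      (unif (biregular n₁ n₂ d₁ d₂)) (5 / m) := by
  have hm0 : (0 : ℝ) < m := by linarith
  have hγ3 : γ ^ 3 ≤ γ := by
    calc γ ^ 3 ≤ γ ^ 1 := pow_le_pow_of_le_one h0.le h1.le (by norm_num)
      _ = γ := pow_one γ
  have hγ2 : γ ^ 2 * m ≤ γ * m := by
    have : γ ^ 2 ≤ γ := by nlinarith
    gcongr
  have hexpL : Real.exp (-Real.log m) = 1 / m := by rw [Real.exp_neg, Real.exp_log hm0, one_div]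
  set p : ℝ := (d₁ : ℝ) * d₂ / m with hpdef
  have hp0 : 0 ≤ p := by positivity
  have hpN : p * ((n₁ * n₂ : ℕ) : ℝ) = m := by
    have e1 : (m : ℝ) = n₁ * d₁ := by exact_mod_cast hm₁
    have e2 : (m : ℝ) = n₂ * d₂ := by exact_mod_cast hm₂
    rw [hpdef, div_mul_eq_mul_div, div_eq_iff hm0.ne']
    push_cast
    nth_rw 1 [e1]
    rw [e2]
    ring
  have ht_nn : 0 ≤ (1 - γ / 4) * (m : ℝ) := mul_nonneg (by linarith) hm0.le
  set t₀ : ℕ := ⌊(1 - γ / 4) * (m : ℝ)⌋₊ with ht₀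
  have ht₀le : (t₀ : ℝ) ≤ (1 - γ / 4) * m := Nat.floor_le ht_nn
  have ht₀ge : (1 - γ / 4) * m < t₀ + 1 := Nat.lt_floor_add_one _
  have hγm0 : 0 < γ * m := by positivity
  have ht₀m : (t₀ : ℝ) ≤ m := by linarith
  have ht₀m' : t₀ ≤ n₁ * d₁ := by rw [← hm₁]; exact_mod_cast ht₀m
  set β : ℝ := Real.exp (-(4 * Real.log m)) with hβ
  have hβ4 : β = 1 / (m : ℝ) ^ 4 := by
    have : -(4 * Real.log m) = ((4 : ℕ) : ℝ) * -Real.log m := by push_cast; ring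
    rw [hβ, this, Real.exp_nat_mul, hexpL, div_pow, one_pow]
  have tail : ∀ t < t₀, ∀ d : ℕ, min d₁ d₂ ≤ d →
      Real.exp (-((1 - (t : ℝ) / ((n₁ * d₁ : ℕ) : ℝ)) * d * (γ / 64) ^ 2 / 4)) ≤ β := by
    intro t ht d hd
    rw [← hm₁]
    refine Real.exp_le_exp.2 (neg_le_neg ?_)
    have hτ : γ / 4 ≤ 1 - (t : ℝ) / m := by
      have : (t : ℝ) / m ≤ 1 - γ / 4 := by
        rw [div_le_iff₀ hm0]
        have : (t : ℝ) ≤ t₀ := by exact_mod_cast ht.le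
        linarith
      linarith
    have hτ0 : 0 ≤ 1 - (t : ℝ) / m := by linarith
    have hd' : ((min d₁ d₂ : ℕ) : ℝ) ≤ d := by exact_mod_cast hd
    calc 4 * Real.log m ≤ γ ^ 3 * ((min d₁ d₂ : ℕ) : ℝ) / 65536 := by linarith
      _ = γ / 4 * ((min d₁ d₂ : ℕ) : ℝ) * (γ / 64) ^ 2 / 4 := by ring
      _ ≤ (1 - (t : ℝ) / m) * d * (γ / 64) ^ 2 / 4 := by gcongr
  have proc := couples_process (n₁ := n₁) (n₂ := n₂) (d₁ := d₁) (d₂ := d₂) (ε := γ / 16)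
    (δ := γ / 64) (β := (n₁ + n₂) * (2 * β)) (by linarith) (by linarith) hn₁ hn₂ hR ht₀m'
    (by
      intro G hG hbal e he
      have hcG : (#G : ℝ) ≤ t₀ := by exact_mod_cast hG.le
      refine hbal.le_card_extensions_insert (hm₁ ▸ hm₂) hn₁ hn₂ hd₁ hd₂ (by linarith)
        (by linarith) ?_ ?_ ?_ he
      · rw [← hm₁]
        linarith
      · rw [← hm₁]
        linarith
      · rw [← hm₁]
        linarith)
    (by
      intro t ht H hH
      exact card_filter_not_balanced_le (mem_biregular.1 hH) (ht.le.trans ht₀m')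
        (by positivity) (by linarith) (by linarith) (tail t ht d₁ (min_le_left _ _))
        (tail t ht d₂ (min_le_right _ _))) t₀ le_rfl
  have small := sum_sprinkled_card_lt_le (n₁ := n₁) (n₂ := n₂) (ε := γ / 16) (q := p) hn₁ hn₂
    (by linarith) (by linarith) (t := t₀) (hpN.symm ▸ ht₀m) k
  refine (couples_withEdges (by linarith) (by linarith) hn₁ hn₂ ht₀m' hkN proc small).mono
    (fun _ _ h => h) ?_
  have b1 : (t₀ : ℝ) * ((n₁ + n₂) * (2 * β)) ≤ 4 / m := by
    have e1 : (n₁ : ℝ) ≤ m := by rw [hm₁]; exact_mod_cast Nat.le_mul_of_pos_right n₁ hd₁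
    have e2 : (n₂ : ℝ) ≤ m := by rw [hm₂]; exact_mod_cast Nat.le_mul_of_pos_right n₂ hd₂
    calc (t₀ : ℝ) * ((n₁ + n₂) * (2 * β)) ≤ m * ((m + m) * (2 * β)) := by
          rw [hβ4]
          gcongr
      _ = 4 / m * (1 / m) := by
          rw [hβ4]
          field_simp
          ring
      _ ≤ 4 / m * 1 := by
          gcongr
          rw [div_le_one hm0]
          linarith
      _ = 4 / m := mul_one _
  have b2 : (2 : ℝ) ^ k * ((1 + (γ / 16 + p)) / 2) ^ t₀ ≤ 1 / m := by
    have l2 : (1 : ℝ) / 2 ≤ Real.log 2 := by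
      have := Real.log_two_gt_d9
      linarith
    have e2 : (2 : ℝ) = Real.exp (Real.log 2) := (Real.exp_log (by norm_num)).symm
    have c1 : (1 + (γ / 16 + p)) / 2 ≤ Real.exp (γ / 8 - Real.log 2) := by
      rw [Real.exp_sub, ← e2]
      have := Real.add_one_le_exp (γ / 8)
      gcongr
      linarith
    calc (2 : ℝ) ^ k * ((1 + (γ / 16 + p)) / 2) ^ t₀
        ≤ Real.exp (Real.log 2) ^ k * Real.exp (γ / 8 - Real.log 2) ^ t₀ := by
          rw [← e2]
          gcongr
      _ = Real.exp (t₀ * (γ / 8) - (t₀ - k) * Real.log 2) := by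
          rw [← Real.exp_nat_mul, ← Real.exp_nat_mul, ← Real.exp_add]
          congr 1
          ring
      _ ≤ Real.exp (-Real.log m) := by
          refine Real.exp_le_exp.2 ?_
          have d1 : 3 / 4 * (γ * m) - 1 ≤ t₀ - k := by linarith
          have d2 : (3 / 4 * (γ * m) - 1) * (1 / 2) ≤ (t₀ - k) * Real.log 2 :=
            mul_le_mul d1 l2 (by norm_num) (by linarith)
          have d3 : t₀ * (γ / 8) ≤ m * (γ / 8) := by gcongr
          linarith
      _ = 1 / m := hexpL
  calc _ ≤ 4 / (m : ℝ) + 1 / m := add_le_add b1 b2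
    _ = 5 / m := by ring

end BipGraph

/-- The term `o(1)` is a function `δ` of `m` alone that tends to `0` as `m → ∞`, uniform in all other
parameters. That the two uniform distributions exist and that `p` is a probability is part of the
conclusion. -/
theorem theoremC1 :
    ∃ C : ℝ, 0 < C ∧ ∃ δ : ℕ → ℝ, Tendsto δ atTop (𝓝 0) ∧
      ∀ n₁ n₂ d₁ d₂ m : ℕ, 0 < n₁ → 0 < n₂ → 0 < d₁ → 0 < d₂ →
        m = n₁ * d₁ → m = n₂ * d₂ →
        ∀ γ : ℝ, 0 < γ → γ < 1 →
          C * ((d₁ : ℝ) * (d₂ : ℝ) / (m : ℝ) +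
            Real.log (m : ℝ) / ((min d₁ d₂ : ℕ) : ℝ)) ^ ((1 : ℝ) / 3) ≤ γ →
          ∃ hR : (BipGraph.biregular n₁ n₂ d₁ d₂).Nonempty,
            (∀ k : ℕ, k ≤ ⌊(1 - γ) * (m : ℝ)⌋₊ →
              ∃ hG : (BipGraph.withEdges n₁ n₂ k).Nonempty,
                ∃ π : PMF (BipGraph n₁ n₂ × BipGraph n₁ n₂),
                  BipGraph.IsCoupling π (PMF.uniformOfFinset (BipGraph.withEdges n₁ n₂ k) hG)
                    (PMF.uniformOfFinset (BipGraph.biregular n₁ n₂ d₁ d₂) hR) ∧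
                  1 - δ m ≤ BipGraph.probSubgraph π) ∧
            (γ ≤ 1 / 2 →
              ∃ hp : (1 - 2 * γ) * (m : ℝ) / ((n₁ : ℝ) * (n₂ : ℝ)) ∈ Set.Icc (0 : ℝ) 1,
                ∃ π : PMF (BipGraph n₁ n₂ × BipGraph n₁ n₂),
                  BipGraph.IsCoupling π
                    (BipGraph.erdosRenyi n₁ n₂ ((1 - 2 * γ) * (m : ℝ) / ((n₁ : ℝ) * (n₂ : ℝ))) hp)
                    (PMF.uniformOfFinset (BipGraph.biregular n₁ n₂ d₁ d₂) hR) ∧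
                  1 - δ m ≤ BipGraph.probSubgraph π) := by
  refine ⟨64, by norm_num, fun m => 6 / m, tendsto_const_div_atTop_nhds_zero_nat 6, ?_⟩
  intro n₁ n₂ d₁ d₂ m hn₁ hn₂ hd₁ hd₂ hm₁ hm₂ γ h0 h1 hγ
  have hmpos : 0 < m := by rw [hm₁]; positivity
  have hm0 : (0 : ℝ) < m := by exact_mod_cast hmpos
  obtain ⟨hp, hD, hm, hL, hγm⟩ := BipGraph.parameter_bounds hd₁ hd₂ hmpos h0 h1 hγ
  -- The edge density `d₁ d₂ / m = d₁ / n₂` is less than one.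
  have hdn : d₁ ≤ n₂ := by
    have hγ3 : γ ^ 3 ≤ 1 := pow_le_one₀ h0.le h1.le
    have hlt : (d₁ : ℝ) * d₂ / m ≤ 1 := by linarith
    rw [div_le_one hm0] at hlt
    have : d₁ * d₂ ≤ n₂ * d₂ := by rw [← hm₂]; exact_mod_cast hlt
    exact Nat.le_of_mul_le_mul_right this hd₂
  have hmN : m ≤ n₁ * n₂ := by rw [hm₁]; exact Nat.mul_le_mul_left n₁ hdn
  have hmN' : (m : ℝ) ≤ (n₁ : ℝ) * n₂ := by exact_mod_cast hmN
  have hR := BipGraph.biregular_nonempty (n₁ := n₁) (hm₁ ▸ hm₂) hdn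
  have hfl : 0 ≤ (1 - γ) * (m : ℝ) := mul_nonneg (by linarith) hm0.le
  have hkbound : ∀ k ≤ ⌊(1 - γ) * (m : ℝ)⌋₊, (k : ℝ) ≤ (1 - γ) * m := fun k hk =>
    (Nat.le_floor_iff hfl).1 hk
  have hkN : ∀ k ≤ ⌊(1 - γ) * (m : ℝ)⌋₊, k ≤ n₁ * n₂ := by
    intro k hk
    refine le_trans ?_ hmN
    have : (k : ℝ) ≤ m := by
      have := hkbound k hk
      have : 0 < γ * m := by positivity
      linarith
    exact_mod_cast this
  have main : ∀ k ≤ ⌊(1 - γ) * (m : ℝ)⌋₊, _ := fun k hk =>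
    BipGraph.couples_withEdges_biregular hn₁ hn₂ hd₁ hd₂ hm₁ hm₂ h0 h1 hp hD hm hL hγm hR
      (hkbound k hk) (hkN k hk)
  refine ⟨hR, fun k hk => ?_, fun hγ2 => ?_⟩
  · have hG := BipGraph.withEdges_nonempty (hkN k hk)
    refine ⟨hG, BipGraph.exists_pmf_of_couples ?_⟩
    rw [BipGraph.toReal_uniformOfFinset, BipGraph.toReal_uniformOfFinset]
    refine (main k hk).mono (fun _ _ h => h) ?_
    exact div_le_div_of_nonneg_right (by norm_num) hm0.le
  · have hN : (0 : ℝ) < (n₁ : ℝ) * n₂ := by positivity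
    have hq : (1 - 2 * γ) * (m : ℝ) / ((n₁ : ℝ) * (n₂ : ℝ)) ∈ Set.Icc (0 : ℝ) 1 := by
      constructor
      · exact div_nonneg (mul_nonneg (by linarith) hm0.le) hN.le
      · rw [div_le_one hN]
        have : 0 < γ * m := by positivity
        linarith
    refine ⟨hq, BipGraph.exists_pmf_of_couples ?_⟩
    rw [BipGraph.toReal_uniformOfFinset, BipGraph.toReal_erdosRenyi]
    have tail := BipGraph.sum_erWeight_card_gt_le (n₁ := n₁) (n₂ := n₂) hq (l := γ / 2)
      (by linarith) (by linarith) (k := ⌊(1 - γ) * (m : ℝ)⌋₊) (Nat.lt_floor_add_one _).le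
    have tail' : Real.exp (-(γ / 2 * ((1 - γ) * m)) + (γ / 2 + (γ / 2) ^ 2) *
        ((1 - 2 * γ) * (m : ℝ) / ((n₁ : ℝ) * (n₂ : ℝ)) * ((n₁ * n₂ : ℕ) : ℝ))) ≤ 1 / m := by
      have e1 : (1 - 2 * γ) * (m : ℝ) / ((n₁ : ℝ) * (n₂ : ℝ)) * ((n₁ * n₂ : ℕ) : ℝ) =
          (1 - 2 * γ) * m := by
        push_cast
        field_simp
      have e2 : 1 / (m : ℝ) = Real.exp (-Real.log m) := by
        rw [Real.exp_neg, Real.exp_log hm0, one_div]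
      rw [e1, e2]
      refine Real.exp_le_exp.2 ?_
      have : 0 < γ ^ 3 * m := by positivity
      linarith
    refine (BipGraph.couples_erWeight hq hR (by positivity) (tail.trans tail') main).mono
      (fun _ _ h => h) (le_of_eq ?_)
    ring
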